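/- Theorem (Weil reciprocity law). Let $k$ be a field and let $X$ be a regular, connected, proper curve over $k$, that is, a connected scheme of dimension one, proper over $\operatorname{Spec} k$, all of whose local rings are regular. (Such an $X$ is integral.) Let $F$ be the field of rational functions on $X$ and let $f, g \in F^{\times}$. For a closed point $p \in X$ let $v_p$ be the order of vanishing at $p$ and $k(p)$ the residue field at $p$. Then: (i) for every closed point $p$, the extension $k(p)/k$ is finite and the rational function $$(-1)^{v_p(f)\, v_p(g)}\, \frac{f^{v_p(g)}}{g^{v_p(f)}}$$ is a unit of the local ring $\mathcal{O}_{X,p}$, so that its value $(f,g)_p \in k(p)^{\times}$ at $p$ (the tame symbol) and the norm $N_{k(p)/k}\big((f,g)_p\big) \in k^{\times}$ are defined; (ii) $(f,g)_p = 1$ for all but finitely many closed points $p$; (iii) $$\prod_{p} N_{k(p)/k}\left( (-1)^{v_p (f)\, v_p (g)}\, \frac{f^{v_p (g)}}{g^{v_p (f)}}\,(p) \right) = 1,$$ the product being taken over all closed points $p$ of $X$. -/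

import Mathlib

universe u

open CategoryTheory AlgebraicGeometry TopologicalSpace

namespace WeilReciprocity

/-- A regular connected curve: a connected, locally Noetherian scheme of dimension one, all of whose
local rings are regular. -/
class IsRegularConnectedCurve (X : Scheme.{u}) : Prop
    extends IsLocallyNoetherian X, ConnectedSpace X where
  regular : ∀ x : X, IsRegularLocalRing (X.presheaf.stalk x)
  dim_eq_one : topologicalKrullDim X = 1

section Integrality

/-- A regular local ring of dimension at most one is a domain. -/
theorem isDomain_of_regular (R : Type*) [CommRing R] [IsRegularLocalRing R]
    (h : ringKrullDim R ≤ 1) : IsDomain R := by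
  open IsLocalRing in
  have hfg : (maximalIdeal R).FG := IsNoetherian.noetherian _
  have hs := IsRegularLocalRing.spanFinrank_maximalIdeal (R := R)
  have hle : (maximalIdeal R).spanFinrank ≤ 1 := by
    rw [← hs] at h
    exact_mod_cast h
  rcases Nat.le_one_iff_eq_zero_or_eq_one.mp hle with h0 | h1
  · have hb : maximalIdeal R = ⊥ := (Submodule.spanFinrank_eq_zero_iff_eq_bot hfg).mp h0
    exact (IsLocalRing.isField_iff_maximalIdeal_eq.mpr hb).isDomain
  · obtain ⟨⟨ϖ, hϖ⟩, -⟩ := (Submodule.spanFinrank_eq_one_iff _).mp h1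
    have hex : ∃ p : Ideal R, p.IsPrime ∧ p ≠ maximalIdeal R := by
      by_contra! hcon
      have : Ring.KrullDimLE 0 R := Ring.krullDimLE_zero_iff.mpr fun I hI ↦ by
        rw [hcon I hI]; infer_instance
      have h2 : ringKrullDim R ≤ 0 := by
        simpa using (Ring.krullDimLE_iff (n := 0)).mp this
      rw [← hs, h1] at h2
      norm_num at h2
    obtain ⟨p, hp, hpm⟩ := hex
    have hple : p ≤ maximalIdeal R := IsLocalRing.le_maximalIdeal hp.ne_top
    have hϖp : ϖ ∉ p := fun hmem ↦ hpm (le_antisymm hple (by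
      rw [hϖ]; exact (Ideal.span_singleton_le_iff_mem _).mpr hmem))
    have hbot : p = ⊥ := by
      refine Submodule.eq_bot_of_le_smul_of_le_jacobson_bot (maximalIdeal R) p
        (IsNoetherian.noetherian p) ?_ (IsLocalRing.maximalIdeal_le_jacobson _)
      intro x hx
      have hxm := hple hx
      rw [hϖ] at hxm
      obtain ⟨y, rfl⟩ := Ideal.mem_span_singleton'.mp hxm
      have hy : y ∈ p := (hp.mem_or_mem hx).resolve_right hϖp
      rw [mul_comm]
      exact Submodule.smul_mem_smul
        (by rw [hϖ]; exact Ideal.mem_span_singleton_self ϖ) hy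
    subst hbot
    exact IsDomain.of_bot_isPrime R

theorem ringKrullDim_stalk_le (X : Scheme.{u}) [IsRegularConnectedCurve X] (x : X) :
    ringKrullDim (X.presheaf.stalk x) ≤ 1 := by
  rw [ringKrullDim_stalk_eq_coheight, ← IsRegularConnectedCurve.dim_eq_one (X := X)]
  refine (Order.coheight_le_krullDim x).trans ?_
  exact (Order.krullDim_eq_of_orderIso (irreducibleSetEquivPoints (α := X))).ge

/-- A connected, locally Noetherian topological space in which the generizations of every point
have a most generic element is irreducible. -/
theorem irreducibleSpace_of_generization (T : Type*) [TopologicalSpace T] [ConnectedSpace T]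
    [QuasiSober T]
    (hloc : ∀ x : T, ∃ U : Opens T, x ∈ U ∧ NoetherianSpace U)
    (hgen : ∀ x : T, ∃ z, z ⤳ x ∧ ∀ w, w ⤳ x → z ⤳ w) : IrreducibleSpace T := by
  choose z hz hz' using hgen
  have key : ∀ x : T, ∃ W : Set T, IsOpen W ∧ x ∈ W ∧ W ⊆ closure {z x} := by
    intro x
    obtain ⟨U, hxU, hU⟩ := hloc x
    have : QuasiSober U := U.isOpenEmbedding'.quasiSober
    have hfin : {C ∈ irreducibleComponents U | (⟨x, hxU⟩ : U) ∉ C}.Finite :=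
      NoetherianSpace.finite_irreducibleComponents.subset fun _ h ↦ h.1
    have hcl : IsClosed (⋃ C ∈ {C ∈ irreducibleComponents U | (⟨x, hxU⟩ : U) ∉ C}, C) :=
      hfin.isClosed_biUnion fun C hC ↦ isClosed_of_mem_irreducibleComponents C hC.1
    refine ⟨Subtype.val '' (⋃ C ∈ {C ∈ irreducibleComponents U | (⟨x, hxU⟩ : U) ∉ C}, C)ᶜ,
      U.isOpen.isOpenMap_subtype_val _ hcl.isOpen_compl, ⟨⟨x, hxU⟩, ?_, rfl⟩, ?_⟩
    · simp
    · rintro _ ⟨y, hy, rfl⟩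
      have hC := irreducibleComponent_mem_irreducibleComponents y
      have hxC : (⟨x, hxU⟩ : U) ∈ irreducibleComponent y := by
        by_contra hcon
        exact hy (Set.mem_biUnion (x := irreducibleComponent y) ⟨hC, hcon⟩ mem_irreducibleComponent)
      obtain ⟨c, hc⟩ := QuasiSober.sober (isIrreducible_irreducibleComponent (x := y))
        isClosed_irreducibleComponent
      have h1 : c.1 ⤳ x := (hc.specializes hxC).map continuous_subtype_val
      have h2 : c.1 ⤳ y.1 := (hc.specializes mem_irreducibleComponent).map continuous_subtype_val
      exact ((hz' x _ h1).trans h2).mem_closure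
  have hirr : ∀ x : T, closure {z x} = Set.univ := by
    intro x
    refine IsClopen.eq_univ ⟨isClosed_closure, ?_⟩ ⟨x, (hz x).mem_closure⟩
    rw [isOpen_iff_mem_nhds]
    intro y hy
    obtain ⟨W, hWo, hyW, hW⟩ := key y
    have h1 : z y ⤳ z x := hz' y _ (specializes_iff_mem_closure.mpr hy)
    have h2 : z x ⤳ z y := hz' x _ (h1.trans (hz x))
    exact Filter.mem_of_superset (hWo.mem_nhds hyW)
      (hW.trans (specializes_iff_closure_subset.mp h2))
  obtain ⟨x⟩ := (inferInstance : Nonempty T)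
  have : IsIrreducible (Set.univ : Set T) := hirr x ▸ isIrreducible_singleton.closure
  exact { isPreirreducible_univ := this.2, toNonempty := ⟨x⟩ }

instance isIntegral_of_regular (X : Scheme.{u}) [IsRegularConnectedCurve X] : IsIntegral X := by
  have hd : ∀ x : X, IsDomain (X.presheaf.stalk x) := fun x ↦
    have := IsRegularConnectedCurve.regular x
    isDomain_of_regular _ (ringKrullDim_stalk_le X x)
  have : IsReduced X := by
    have : ∀ x : X, _root_.IsReduced (X.presheaf.stalk x) := fun x ↦
      have := hd x
      inferInstance
    exact isReduced_of_isReduced_stalk X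
  have : IrreducibleSpace X := by
    refine irreducibleSpace_of_generization X (fun x ↦ ?_) fun x ↦ ?_
    · obtain ⟨U, hU, hxU, -⟩ := exists_isAffineOpen_mem_and_subset (U := (⊤ : X.Opens)) (x := x)
        (by simp)
      have : IsNoetherianRing Γ(X, U) := IsLocallyNoetherian.component_noetherian ⟨U, hU⟩
      exact ⟨U, hxU, noetherianSpace_of_isAffineOpen U hU⟩
    · have := hd x
      refine ⟨X.fromSpecStalk x (genericPoint (Spec (X.presheaf.stalk x))), ?_, ?_⟩
      · have : X.fromSpecStalk x (genericPoint (Spec (X.presheaf.stalk x))) ∈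
          Set.range (X.fromSpecStalk x) := ⟨_, rfl⟩
        rw [X.range_fromSpecStalk] at this
        exact this
      · intro w hw
        have : w ∈ Set.range (X.fromSpecStalk x) := by
          rw [X.range_fromSpecStalk]
          exact hw
        obtain ⟨v, rfl⟩ := this
        exact (genericPoint_specializes v).map (X.fromSpecStalk x).continuous
  exact isIntegral_of_irreducibleSpace_of_isReduced X

end Integrality

section TameSymbol

variable {X : Scheme.{u}} [IsIntegral X]

open scoped Classical in
/-- The value `φ(p)`, in the residue field at `p`, of a rational function `φ` which belongs to the
local ring at `p` (and `0` if `φ` does not belong to it). -/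
noncomputable def valueAt (φ : X.functionField) (p : X) : X.residueField p :=
  if h : ∃ a : X.presheaf.stalk p, algebraMap (X.presheaf.stalk p) X.functionField a = φ then
    X.residue p h.choose
  else 0

theorem valueAt_algebraMap (p : X) (a : X.presheaf.stalk p) :
    valueAt (algebraMap (X.presheaf.stalk p) X.functionField a) p = X.residue p a := by
  have h : ∃ b : X.presheaf.stalk p, algebraMap (X.presheaf.stalk p) X.functionField b =
    algebraMap (X.presheaf.stalk p) X.functionField a := ⟨a, rfl⟩
  rw [valueAt, dif_pos h,
    IsFractionRing.injective (X.presheaf.stalk p) X.functionField h.choose_spec]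

variable [IsLocallyNoetherian X]

/-- The rational function `(-1)^(v_p(f) v_p(g)) f^(v_p(g)) / g^(v_p(f))`. -/
noncomputable def tameFunction (f g : X.functionField) (p : X) : X.functionField :=
  (-1) ^ (Scheme.ord f p * Scheme.ord g p) * (f ^ Scheme.ord g p / g ^ Scheme.ord f p)

/-- The tame symbol of `f` and `g` at `p`. -/
noncomputable def tameSymbol (f g : X.functionField) (p : X) : X.residueField p :=
  valueAt (tameFunction f g p) p

end TameSymbol

section Norm

variable {k : Type u} [Field k] {X : Scheme.{u}}

/-- The homomorphism `k → k(p)` given by the composition `Spec k(p) → X → Spec k`. -/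
noncomputable def toResidueField (s : X ⟶ Spec (.of k)) (p : X) : k →+* X.residueField p :=
  (Spec.preimage (X.fromSpecResidueField p ≫ s)).hom

/-- The norm `N_{k(p)/k}`. -/
noncomputable def residueNorm (s : X ⟶ Spec (.of k)) (p : X) : X.residueField p →* k :=
  letI := (toResidueField s p).toAlgebra
  Algebra.norm k

end Norm

end WeilReciprocity

/-! The curve is replaced by its function field `F` and the discrete valuation rings at its closed
points. By regularity and the valuative criteria these are exactly the nontrivial valuation rings of
`F` over `k`, without repetition (`IsCompletePlaces`). Let ⟨f, g⟩ be the product over all places of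
the norms of the tame symbols. It is bimultiplicative, ⟨f, g⟩⟨g, f⟩ = 1, and ⟨f, 1 - f⟩ = 1, because
this holds at every place.

Disjoint supports (`finprod_norm_tame_of_disjoint`). Let t be transcendental and g without zeros or
poles in common with t. Put h = N(g), the norm from F to k(t). The normed values of g multiply to
h(0) over the zeros of t and to h(∞) over its poles; those of t over the divisor of g multiply to
the product of the roots of the numerator of h divided by that of its denominator. The claim becomes
Vieta's formula for h. These values are determinants: with R the integral closure of k[t], the
determinant of multiplication by b on R/(a) is computed once from the prime factorization of (a) and
once, when a or b is t, from the norm to k[t]. Separability of F/k(t) plays no role: R is finite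
over k[t] because the curve has finitely generated, integrally closed affine charts.

Common supports (`symbol_eq_one`). By weak approximation, a bimultiplicative symbol that is trivial
on disjoint supports equals ∏ Λ_p ^ (v_p(f) v_p(g)) for constants Λ_p. Antisymmetry gives Λ_p² = 1.
The Steinberg relation for some y with a simple pole at p and all other poles of even order leaves
Λ_p = 1. -/

namespace WeilReciprocity

/-! ### The tame symbol of a discrete valuation ring -/

section Local

open IsLocalRing

variable (O : Type*) [CommRing O] [IsDomain O] [IsDiscreteValuationRing O]
  {F : Type*} [Field F] [Algebra O F] [IsFractionRing O F]

/-- The normalized additive valuation of the fraction field of a discrete valuation ring, with the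
junk value `0` at `0`. -/
noncomputable def ordv (x : F) : ℤ := Multiplicative.toAdd ((Ring.ordFrac O x).unzeroD 1)

open scoped Classical in
/-- The residue of an integral element of the fraction field (and `0` for other elements). -/
noncomputable def value (x : F) : ResidueField O :=
  if h : ∃ a : O, algebraMap O F a = x then residue O h.choose else 0

/-- The element `(-1)^(v(f) v(g)) f^(v(g)) / g^(v(f))`. -/
noncomputable def tameFn (f g : F) : F :=
  (-1) ^ (ordv O f * ordv O g) * (f ^ ordv O g / g ^ ordv O f)

/-- The tame symbol of a discrete valuation ring. -/
noncomputable def tame (f g : F) : ResidueField O := value O (tameFn O f g)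

theorem value_algebraMap (a : O) : value O (algebraMap O F a) = residue O a := by
  have h : ∃ b : O, algebraMap O F b = algebraMap O F a := ⟨a, rfl⟩
  rw [value, dif_pos h, IsFractionRing.injective O F h.choose_spec]

theorem ordFrac_eq_exp_ordv {x : F} (hx : x ≠ 0) :
    Ring.ordFrac O x = WithZero.exp (ordv O x) := by
  have h : Ring.ordFrac O x ≠ 0 := by simpa using hx
  obtain ⟨m, hm⟩ := WithZero.ne_zero_iff_exists.mp h
  rw [ordv, ← hm]
  rfl

theorem ordv_eq_iff {x : F} (hx : x ≠ 0) {n : ℤ} :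
    ordv O x = n ↔ Ring.ordFrac O x = WithZero.exp n := by
  rw [ordFrac_eq_exp_ordv O hx, WithZero.exp_inj]

theorem ordv_mul {x y : F} (hx : x ≠ 0) (hy : y ≠ 0) :
    ordv O (x * y) = ordv O x + ordv O y := by
  rw [ordv_eq_iff O (mul_ne_zero hx hy), map_mul, ordFrac_eq_exp_ordv O hx,
    ordFrac_eq_exp_ordv O hy, WithZero.exp_add]

@[simp]
theorem ordv_one : ordv O (1 : F) = 0 := by
  rw [ordv_eq_iff O one_ne_zero, map_one, WithZero.exp_zero]

theorem ordv_inv {x : F} (hx : x ≠ 0) : ordv O x⁻¹ = -ordv O x := by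
  have := ordv_mul O hx (inv_ne_zero hx)
  rw [mul_inv_cancel₀ hx, ordv_one] at this
  linarith

theorem ordv_div {x y : F} (hx : x ≠ 0) (hy : y ≠ 0) :
    ordv O (x / y) = ordv O x - ordv O y := by
  rw [div_eq_mul_inv, ordv_mul O hx (inv_ne_zero hy), ordv_inv O hy, sub_eq_add_neg]

theorem ordv_pow {x : F} (hx : x ≠ 0) (n : ℕ) : ordv O (x ^ n) = n * ordv O x := by
  induction n with
  | zero => simp
  | succ n ih => rw [pow_succ, ordv_mul O (pow_ne_zero _ hx) hx, ih]; push_cast; ring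

theorem ordv_zpow {x : F} (hx : x ≠ 0) (n : ℤ) : ordv O (x ^ n) = n * ordv O x := by
  obtain ⟨m, rfl | rfl⟩ := n.eq_nat_or_neg
  · rw [zpow_natCast, ordv_pow O hx]
  · rw [zpow_neg, zpow_natCast, ordv_inv O (pow_ne_zero _ hx), ordv_pow O hx]; ring

@[simp]
theorem ordv_neg (x : F) : ordv O (-x) = ordv O x := by
  rcases eq_or_ne x 0 with rfl | hx
  · simp
  have h1 : ordv O (-1 : F) = 0 := by
    have := ordv_mul O (x := (-1 : F)) (y := -1) (by simp) (by simp)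
    rw [neg_one_mul, neg_neg, ordv_one] at this
    linarith
  rw [← neg_one_mul, ordv_mul O (by simp) hx, h1, zero_add]

theorem ordv_add {x y : F} (h : x + y ≠ 0) (hx : x ≠ 0) (hy : y ≠ 0) :
    min (ordv O x) (ordv O y) ≤ ordv O (x + y) := by
  have := Ring.ordFrac_add (R := O) x y h
  rw [ordFrac_eq_exp_ordv O hx, ordFrac_eq_exp_ordv O hy, ordFrac_eq_exp_ordv O h] at this
  simpa [inf_le_iff] using this

theorem ordv_add_of_lt {x y : F} (hx : x ≠ 0) (hy : y ≠ 0) (h : ordv O x < ordv O y) :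
    x + y ≠ 0 ∧ ordv O (x + y) = ordv O x := by
  have h0 : x + y ≠ 0 := by
    intro h0
    rw [eq_neg_of_add_eq_zero_left h0, ordv_neg] at h
    exact lt_irrefl _ h
  refine ⟨h0, le_antisymm ?_ ?_⟩
  · have := ordv_add O (x := x + y) (y := -y) (by simpa using hx) h0 (by simpa using hy)
    rw [add_neg_cancel_right, ordv_neg, min_le_iff] at this
    exact this.resolve_right (not_le.mpr h)
  · simpa [min_eq_left h.le] using ordv_add O h0 hx hy

theorem ordv_algebraMap_nonneg (a : O) : 0 ≤ ordv O (algebraMap O F a) := by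
  rcases eq_or_ne a 0 with rfl | ha
  · simp [ordv]
  have ha' : algebraMap O F a ≠ 0 := by simpa using ha
  have := Ring.ordFrac_ge_one_of_ne_zero (K := F) ha
  rw [ordFrac_eq_exp_ordv O ha', ← WithZero.exp_zero, WithZero.exp_le_exp] at this
  exact this

theorem ordv_algebraMap_eq_zero_iff {a : O} (ha : a ≠ 0) :
    ordv O (algebraMap O F a) = 0 ↔ IsUnit a := by
  rw [ordv_eq_iff O (by simpa using ha), WithZero.exp_zero,
    Ring.isUnit_iff_ordFrac_one_of_isDiscreteValuationRing (K := F)]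

theorem ordv_irreducible {ϖ : O} (hϖ : Irreducible ϖ) : ordv O (algebraMap O F ϖ) = 1 := by
  rw [ordv_eq_iff O (by simpa using hϖ.ne_zero), Ring.ordFrac_irreducible hϖ]

variable (F) in
theorem exists_ordv_eq_one : ∃ x : F, x ≠ 0 ∧ ordv O x = 1 := by
  obtain ⟨ϖ, hϖ⟩ := IsDiscreteValuationRing.exists_irreducible O
  exact ⟨algebraMap O F ϖ, by simpa using hϖ.ne_zero, ordv_irreducible O hϖ⟩

theorem exists_unit_of_ordv_eq_zero {x : F} (hx : x ≠ 0) (h : ordv O x = 0) :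
    ∃ u : Oˣ, algebraMap O F u = x := by
  obtain ⟨a, b, hb, rfl⟩ := IsFractionRing.div_surjective (A := O) x
  have ha0 : a ≠ 0 := by rintro rfl; simp at hx
  have hb0 : b ≠ 0 := nonZeroDivisors.ne_zero hb
  obtain ⟨ϖ, hϖ⟩ := IsDiscreteValuationRing.exists_irreducible O
  obtain ⟨m, u, rfl⟩ := IsDiscreteValuationRing.eq_unit_mul_pow_irreducible ha0 hϖ
  obtain ⟨n, w, rfl⟩ := IsDiscreteValuationRing.eq_unit_mul_pow_irreducible hb0 hϖ
  have hπ : algebraMap O F ϖ ≠ 0 := by simpa using hϖ.ne_zero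
  have hu (u : Oˣ) : algebraMap O F u ≠ 0 := by simp
  have hou (u : Oˣ) : ordv O (algebraMap O F u) = 0 :=
    (ordv_algebraMap_eq_zero_iff O u.ne_zero).mpr u.isUnit
  simp only [map_mul, map_pow] at h ⊢
  rw [ordv_div O (mul_ne_zero (hu _) (pow_ne_zero _ hπ)) (mul_ne_zero (hu _) (pow_ne_zero _ hπ)),
    ordv_mul O (hu _) (pow_ne_zero _ hπ), ordv_mul O (hu _) (pow_ne_zero _ hπ), hou, hou,
    ordv_pow O hπ, ordv_pow O hπ, ordv_irreducible O hϖ] at h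
  obtain rfl : m = n := by omega
  refine ⟨u * w⁻¹, ?_⟩
  rw [mul_div_mul_right _ _ (pow_ne_zero _ hπ), eq_div_iff (hu w), ← map_mul]
  simp

theorem ordv_nonneg_iff {x : F} (hx : x ≠ 0) :
    0 ≤ ordv O x ↔ ∃ a : O, algebraMap O F a = x := by
  refine ⟨fun h ↦ ?_, ?_⟩
  · obtain ⟨ϖ, hϖ⟩ := IsDiscreteValuationRing.exists_irreducible O
    have hπ : algebraMap O F ϖ ≠ 0 := by simpa using hϖ.ne_zero
    obtain ⟨n, hn⟩ := Int.eq_ofNat_of_zero_le h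
    obtain ⟨u, hu⟩ := exists_unit_of_ordv_eq_zero O (x := x / algebraMap O F ϖ ^ n)
      (div_ne_zero hx (pow_ne_zero _ hπ)) (by
        rw [ordv_div O hx (pow_ne_zero _ hπ), ordv_pow O hπ, ordv_irreducible O hϖ, hn]; simp)
    exact ⟨u * ϖ ^ n, by rw [map_mul, hu, map_pow, div_mul_cancel₀ _ (pow_ne_zero _ hπ)]⟩
  · rintro ⟨a, rfl⟩
    exact ordv_algebraMap_nonneg O a

theorem residue_eq_zero_iff_ordv_pos {a : O} (ha : a ≠ 0) :
    residue O a = 0 ↔ 0 < ordv O (algebraMap O F a) := by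
  rw [residue_eq_zero_iff, mem_maximalIdeal, mem_nonunits_iff,
    ← ordv_algebraMap_eq_zero_iff (F := F) O ha]
  have := ordv_algebraMap_nonneg (F := F) O a
  omega

@[simp]
theorem value_one : value O (1 : F) = 1 := by
  rw [← map_one (algebraMap O F), value_algebraMap, map_one]

theorem value_mul {x y : F} (hx : x ≠ 0) (hy : y ≠ 0) (hx' : 0 ≤ ordv O x) (hy' : 0 ≤ ordv O y) :
    value O (x * y) = value O x * value O y := by
  obtain ⟨a, rfl⟩ := (ordv_nonneg_iff O hx).mp hx'
  obtain ⟨b, rfl⟩ := (ordv_nonneg_iff O hy).mp hy'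
  rw [← map_mul, value_algebraMap, value_algebraMap, value_algebraMap, map_mul]

theorem value_ne_zero {x : F} (hx : x ≠ 0) (h : ordv O x = 0) : value O x ≠ 0 := by
  obtain ⟨u, rfl⟩ := exists_unit_of_ordv_eq_zero O hx h
  rw [value_algebraMap]
  exact (u.isUnit.map (residue O)).ne_zero

theorem value_inv {x : F} (hx : x ≠ 0) (h : ordv O x = 0) : value O x⁻¹ = (value O x)⁻¹ := by
  refine eq_inv_of_mul_eq_one_left ?_
  rw [← value_mul O (inv_ne_zero hx) hx (by rw [ordv_inv O hx, h, neg_zero]) h.ge,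
    inv_mul_cancel₀ hx, value_one]

theorem value_pow {x : F} (hx : x ≠ 0) (h : 0 ≤ ordv O x) (n : ℕ) :
    value O (x ^ n) = value O x ^ n := by
  obtain ⟨a, rfl⟩ := (ordv_nonneg_iff O hx).mp h
  rw [← map_pow, value_algebraMap, value_algebraMap, map_pow]

theorem value_zpow {x : F} (hx : x ≠ 0) (h : ordv O x = 0) (n : ℤ) :
    value O (x ^ n) = value O x ^ n := by
  obtain ⟨m, rfl | rfl⟩ := n.eq_nat_or_neg
  · simp [value_pow O hx h.ge]
  · rw [zpow_neg, zpow_natCast, value_inv O (pow_ne_zero _ hx) (by rw [ordv_pow O hx, h, mul_zero]),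
      value_pow O hx h.ge]
    simp

theorem value_add_of_ordv_pos {x y : F} (hxy : x + y = 1) (hy : y ≠ 0) (h : 0 < ordv O y) :
    value O x = 1 := by
  obtain ⟨b, rfl⟩ := (ordv_nonneg_iff O hy).mp h.le
  have hx : x = algebraMap O F (1 - b) := by rw [map_sub, map_one, ← hxy, add_sub_cancel_right]
  have hb : b ≠ 0 := by rintro rfl; simp at hy
  rw [hx, value_algebraMap, map_sub, (residue_eq_zero_iff_ordv_pos (F := F) O hb).mpr h, map_one,
    sub_zero]

variable {O}

theorem tameFn_ne_zero {f g : F} (hf : f ≠ 0) (hg : g ≠ 0) : tameFn O f g ≠ 0 :=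
  mul_ne_zero (zpow_ne_zero _ (by simp)) (div_ne_zero (zpow_ne_zero _ hf) (zpow_ne_zero _ hg))

theorem ordv_tameFn {f g : F} (hf : f ≠ 0) (hg : g ≠ 0) : ordv O (tameFn O f g) = 0 := by
  rw [tameFn, ordv_mul O (zpow_ne_zero _ (by simp))
    (div_ne_zero (zpow_ne_zero _ hf) (zpow_ne_zero _ hg)), ordv_zpow O (by simp), ordv_neg,
    ordv_one, ordv_div O (zpow_ne_zero _ hf) (zpow_ne_zero _ hg), ordv_zpow O hf, ordv_zpow O hg]
  ring

theorem tame_ne_zero {f g : F} (hf : f ≠ 0) (hg : g ≠ 0) : tame O f g ≠ 0 :=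
  value_ne_zero O (tameFn_ne_zero hf hg) (ordv_tameFn hf hg)

theorem tame_eq_of_tameFn_eq_mul {f g f₁ g₁ f₂ g₂ : F} (h1f : f₁ ≠ 0) (h1g : g₁ ≠ 0)
    (h2f : f₂ ≠ 0) (h2g : g₂ ≠ 0) (h : tameFn O f g = tameFn O f₁ g₁ * tameFn O f₂ g₂) :
    tame O f g = tame O f₁ g₁ * tame O f₂ g₂ := by
  rw [tame, h, value_mul O (tameFn_ne_zero h1f h1g) (tameFn_ne_zero h2f h2g)
    (ordv_tameFn h1f h1g).ge (ordv_tameFn h2f h2g).ge, tame, tame]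

theorem tame_mul_left {f₁ f₂ g : F} (h1 : f₁ ≠ 0) (h2 : f₂ ≠ 0) (hg : g ≠ 0) :
    tame O (f₁ * f₂) g = tame O f₁ g * tame O f₂ g := by
  refine tame_eq_of_tameFn_eq_mul h1 hg h2 hg ?_
  simp only [tameFn, ordv_mul O h1 h2, add_mul, zpow_add₀ hg, mul_zpow,
    zpow_add₀ (neg_ne_zero.mpr (one_ne_zero (α := F)))]
  field_simp

theorem tame_mul_tame_swap {f g : F} (hf : f ≠ 0) (hg : g ≠ 0) :
    tame O f g * tame O g f = 1 := by
  rw [← tame_eq_of_tameFn_eq_mul (f := 1) (g := 1) hf hg hg hf, tame, tameFn]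
  · simp
  · simp only [tameFn, ordv_one, mul_comm (ordv O g) (ordv O f)]
    have h1 : ((-1 : F) ^ (ordv O f * ordv O g)) * (-1 : F) ^ (ordv O f * ordv O g) = 1 := by
      rw [← mul_zpow]; simp
    have h2 := zpow_ne_zero (ordv O g) hf
    have h3 := zpow_ne_zero (ordv O f) hg
    rw [mul_mul_mul_comm, h1, div_mul_div_comm, mul_comm (g ^ _), div_self (mul_ne_zero h2 h3)]
    simp

theorem tame_mul_right {f g₁ g₂ : F} (hf : f ≠ 0) (h1 : g₁ ≠ 0) (h2 : g₂ ≠ 0) :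
    tame O f (g₁ * g₂) = tame O f g₁ * tame O f g₂ := by
  rw [eq_inv_of_mul_eq_one_left (tame_mul_tame_swap hf (mul_ne_zero h1 h2)),
    tame_mul_left h1 h2 hf, eq_inv_of_mul_eq_one_left (tame_mul_tame_swap hf h1),
    eq_inv_of_mul_eq_one_left (tame_mul_tame_swap hf h2), mul_inv]

theorem tame_of_ordv_left_eq_zero {f g : F} (hf : f ≠ 0) (h : ordv O f = 0) :
    tame O f g = value O f ^ ordv O g := by
  simp [tame, tameFn, h, value_zpow O hf h]

theorem tame_of_ordv_right_eq_zero {f g : F} (hg : g ≠ 0) (h : ordv O g = 0) :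
    tame O f g = value O g ^ (-ordv O f) := by
  simp only [tame, tameFn, h, mul_zero, zpow_zero, one_mul, one_div]
  rw [← zpow_neg, value_zpow O hg h]

theorem ordv_eq_of_add_eq_one {f g : F} (hf : f ≠ 0) (h : f + g = 1)
    (hneg : ordv O f < 0) : ordv O g = ordv O f := by
  have := (ordv_add_of_lt O (x := -f) (y := 1) (by simpa) one_ne_zero (by simpa)).2
  rwa [show -f + 1 = g by rw [← h]; ring, ordv_neg] at this

theorem ordv_eq_zero_of_add_eq_one {f g : F} (hf : f ≠ 0) (h : f + g = 1)
    (hpos : 0 < ordv O f) : ordv O g = 0 := by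
  have := (ordv_add_of_lt O (x := 1) (y := -f) one_ne_zero (by simpa) (by simpa)).2
  rwa [show 1 + -f = g by rw [← h]; ring, ordv_one] at this

theorem tame_eq_one_of_add_eq_one {f g : F} (hf : f ≠ 0) (hg : g ≠ 0) (h : f + g = 1) :
    tame O f g = 1 := by
  rcases lt_trichotomy (ordv O f) 0 with hneg | h0 | hpos
  -- When `f` has a pole, `g` has one of the same order, so `1 / g` vanishes and `-(f / g) = 1 - 1 /
  -- g` has value 1.
  · have hog := ordv_eq_of_add_eq_one hf h hneg
    have hfn : tameFn O f g = (-1) ^ (ordv O f * ordv O f) * ((f / g) ^ ordv O f) := by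
      rw [tameFn, hog, div_zpow]
    have hfg' : -(f / g) + 1 / g = 1 := by field_simp; rw [← h]; ring
    have hv : value O (-(f / g)) = 1 := by
      refine value_add_of_ordv_pos O hfg' (by simpa) ?_
      rw [one_div, ordv_inv O hg, hog]; omega
    have hd : ordv O (f / g) = 0 := by rw [ordv_div O hf hg, hog, sub_self]
    have hd' : f / g ≠ 0 := div_ne_zero hf hg
    have hv' : tameFn O f g = (-(f / g)) ^ ordv O f := by
      rw [hfn, ← neg_one_mul (f / g), mul_zpow]
      congr 1
      -- An integer and its square have the same parity, so the sign is absorbed into the base `-(f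
      -- / g)`.
      rcases Int.even_or_odd (ordv O f) with he | ho
      · rw [he.neg_one_zpow, (he.mul_left _).neg_one_zpow]
      · rw [ho.neg_one_zpow, (ho.mul ho).neg_one_zpow]
    rw [tame, hv', value_zpow O (neg_ne_zero.mpr hd') (by rwa [ordv_neg]), hv, one_zpow]
  · rw [tame_of_ordv_left_eq_zero hf h0]
    rcases eq_or_ne (ordv O g) 0 with hg0 | hg0
    · rw [hg0, zpow_zero]
    · rcases hg0.lt_or_gt with hlt | hlt
      · have := ordv_eq_of_add_eq_one hg (by rwa [add_comm]) hlt
        omega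
      · rw [value_add_of_ordv_pos O h hg hlt, one_zpow]
  · rw [tame_of_ordv_right_eq_zero hg (ordv_eq_zero_of_add_eq_one hf h hpos),
      value_add_of_ordv_pos O (by rwa [add_comm]) hf hpos, one_zpow]

end Local

/-! ### Bimultiplicative symbols trivial on disjoint supports -/

section Symbols

open Multiplicative

variable {G C P : Type*} [CommGroup G] [CommGroup C] (v : P → G →* Multiplicative ℤ)
  (φ : G →* G →* C)

/-- Two elements of a group with valuations have order one at `p` and no other common support. -/
def IsPairAt (p : P) (a b : G) : Prop :=
  toAdd (v p a) = 1 ∧ toAdd (v p b) = 1 ∧ ∀ q, q ≠ p → toAdd (v q a) = 0 ∨ toAdd (v q b) = 0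

variable {v φ}

/-- The quotient `g / g'` has order zero on the support of `f`, so its symbol with `f` is trivial.
-/
theorem symbol_congr_right (h0 : ∀ f g, (∀ p, toAdd (v p f) = 0 ∨ toAdd (v p g) = 0) → φ f g = 1)
    {f g g' : G} (h : ∀ p, toAdd (v p f) ≠ 0 → toAdd (v p g) = toAdd (v p g')) :
    φ f g = φ f g' := by
  have := h0 f (g / g') fun p ↦ by
    by_cases hp : toAdd (v p f) = 0
    · exact .inl hp
    · exact .inr (by rw [map_div, toAdd_div, h p hp, sub_self])
  rwa [map_div, div_eq_one] at this

theorem symbol_congr_left (h0 : ∀ f g, (∀ p, toAdd (v p f) = 0 ∨ toAdd (v p g) = 0) → φ f g = 1)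
    {f f' g : G} (h : ∀ p, toAdd (v p g) ≠ 0 → toAdd (v p f) = toAdd (v p f')) :
    φ f g = φ f' g :=
  symbol_congr_right (φ := φ.flip) (fun f g hfg ↦ h0 g f fun p ↦ (hfg p).symm) h

theorem exists_eq_one_of_approx [DecidableEq P]
    (approx : ∀ (S : Finset P) (n : P → ℤ), ∃ f : G, ∀ p ∈ S, toAdd (v p f) = n p)
    (S : Finset P) (p : P) :
    ∃ f : G, toAdd (v p f) = 1 ∧ ∀ q ∈ S, q ≠ p → toAdd (v q f) = 0 := by
  obtain ⟨f, hf⟩ := approx (insert p S) (Pi.single p 1)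
  refine ⟨f, by rw [hf p (by simp), Pi.single_eq_same], fun q hq hqp ↦ ?_⟩
  rw [hf q (by simp [-toAdd_eq_zero, hq]), Pi.single_eq_of_ne hqp]

/-- Both pairs are compared through one second entry `c`, of order one at `p` and of order zero at
the other points of the supports of `a` and `a'`. Against `c` the first entry counts only through
its order at `p`. -/
theorem symbol_eq_of_isPairAt [DecidableEq P]
    (h0 : ∀ f g, (∀ p, toAdd (v p f) = 0 ∨ toAdd (v p g) = 0) → φ f g = 1)
    (fin : ∀ f : G, {p | toAdd (v p f) ≠ 0}.Finite)
    (approx : ∀ (S : Finset P) (n : P → ℤ), ∃ f : G, ∀ p ∈ S, toAdd (v p f) = n p)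
    {p : P} {a b a' b' : G} (h : IsPairAt v p a b) (h' : IsPairAt v p a' b') :
    φ a b = φ a' b' := by
  obtain ⟨c, hc, hc'⟩ := exists_eq_one_of_approx approx ((fin a).toFinset ∪ (fin a').toFinset) p
  simp only [Finset.mem_union, Set.Finite.mem_toFinset, Set.mem_ofPred_eq] at hc'
  have hb : φ a b = φ a c := symbol_congr_right h0 fun q hq ↦ by
    rcases eq_or_ne q p with rfl | hqp
    · rw [h.2.1, hc]
    · rw [hc' q (.inl hq) hqp, (h.2.2 q hqp).resolve_left hq]
  have hb' : φ a' b' = φ a' c := symbol_congr_right h0 fun q hq ↦ by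
    rcases eq_or_ne q p with rfl | hqp
    · rw [h'.2.1, hc]
    · rw [hc' q (.inr hq) hqp, (h'.2.2 q hqp).resolve_left hq]
  rw [hb, hb']
  refine symbol_congr_left h0 fun q hq ↦ ?_
  rcases eq_or_ne q p with rfl | hqp
  · rw [h.1, h'.1]
  · have h1 : toAdd (v q a) = 0 := by
      by_contra hcon; exact hq (hc' q (.inl hcon) hqp)
    have h2 : toAdd (v q a') = 0 := by
      by_contra hcon; exact hq (hc' q (.inr hcon) hqp)
    rw [h1, h2]

/-- A bimultiplicative symbol which is trivial on elements with disjoint supports is a product of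
local contributions which depend only on the orders. -/
theorem exists_symbol_eq_prod
    (h0 : ∀ f g, (∀ p, toAdd (v p f) = 0 ∨ toAdd (v p g) = 0) → φ f g = 1)
    (fin : ∀ f : G, {p | toAdd (v p f) ≠ 0}.Finite)
    (approx : ∀ (S : Finset P) (n : P → ℤ), ∃ f : G, ∀ p ∈ S, toAdd (v p f) = n p) :
    ∃ Λ : P → C, (∀ p a b, IsPairAt v p a b → Λ p = φ a b) ∧ (∀ p, ∃ a b, IsPairAt v p a b) ∧
      ∀ (f g : G) (S : Finset P), (∀ p, toAdd (v p f) ≠ 0 → p ∈ S) →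
        (∀ p, toAdd (v p g) ≠ 0 → p ∈ S) →
        φ f g = ∏ p ∈ S, Λ p ^ (toAdd (v p f) * toAdd (v p g)) := by
  classical
  have hex (p : P) : ∃ a b, IsPairAt v p a b := by
    obtain ⟨a, ha, -⟩ := exists_eq_one_of_approx approx ∅ p
    obtain ⟨b, hb, hb'⟩ := exists_eq_one_of_approx approx (fin a).toFinset p
    refine ⟨a, b, ha, hb, fun q hqp ↦ ?_⟩
    by_cases hq : toAdd (v q a) = 0
    · exact .inl hq
    · exact .inr (hb' q (by simpa using hq) hqp)
  choose A B hAB using hex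
  have hΛ (p : P) (a b : G) (h : IsPairAt v p a b) : φ (A p) (B p) = φ a b :=
    symbol_eq_of_isPairAt h0 fin approx (hAB p) h
  refine ⟨fun p ↦ φ (A p) (B p), hΛ, fun p ↦ ⟨A p, B p, hAB p⟩, fun f g S hfS hgS ↦ ?_⟩
  choose a ha ha' using exists_eq_one_of_approx approx S
  -- Enlarging `S` by the supports of all `a p` makes `b p` meet `a p` only at `p`, and `b q`
  -- disjoint from `a p` for `q ≠ p` in `S`.
  let S' : Finset P := S ∪ S.biUnion fun p ↦ (fin (a p)).toFinset
  choose b hb hb' using exists_eq_one_of_approx approx S'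
  have hSS' : S ⊆ S' := Finset.subset_union_left
  have key (c : P → G) (hc : ∀ p, toAdd (v p (c p)) = 1)
      (hc' : ∀ p, ∀ q ∈ S, q ≠ p → toAdd (v q (c p)) = 0) (n : P → ℤ) (q : P) (hq : q ∈ S) :
      toAdd (v q (∏ p ∈ S, c p ^ n p)) = n q := by
    rw [map_prod, toAdd_prod, Finset.sum_eq_single q]
    · simp [hc]
    · intro p _ hpq
      simp [hc' p q hq hpq.symm]
    · exact fun h ↦ (h hq).elim
  have h1 : φ f g = φ (∏ p ∈ S, a p ^ toAdd (v p f)) g := symbol_congr_left h0 fun q hq ↦ by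
    rw [key a ha ha' _ q (hgS q hq)]
  -- The support of the first entry now lies in `S'`; at points of `S'` outside `S` both `g` and the
  -- product of the `b p` have order zero.
  have h2 : φ (∏ p ∈ S, a p ^ toAdd (v p f)) g =
      φ (∏ p ∈ S, a p ^ toAdd (v p f)) (∏ p ∈ S, b p ^ toAdd (v p g)) := by
    refine symbol_congr_right h0 fun q hq ↦ ?_
    by_cases hqS : q ∈ S
    · rw [key b hb (fun p r hr ↦ hb' p r (hSS' hr)) _ q hqS]
    · have hqS' : q ∈ S' := by
        by_contra hcon
        simp only [S', Finset.mem_union, Finset.mem_biUnion, Set.Finite.mem_toFinset,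
          Set.mem_ofPred_eq, not_or, not_exists, not_and, not_not] at hcon
        refine hq ?_
        rw [map_prod, toAdd_prod]
        exact Finset.sum_eq_zero fun p hp ↦ by simp [hcon.2 p hp]
      have h3 : toAdd (v q g) = 0 := by
        by_contra hcon; exact hqS (hgS q hcon)
      rw [h3, map_prod, toAdd_prod, Finset.sum_eq_zero]
      intro p hp
      simp [hb' p q hqS' (by rintro rfl; exact hqS hp)]
  rw [h1, h2, map_prod φ, MonoidHom.finsetProd_apply]
  refine Finset.prod_congr rfl fun p hp ↦ ?_
  rw [map_prod, Finset.prod_eq_single p]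
  · rw [map_zpow, map_zpow, MonoidHom.zpow_apply, ← zpow_mul]
    beta_reduce
    rw [hΛ p (a p) (b p) ⟨ha p, hb p, fun q hqp ↦ ?_⟩]
    by_cases hq : toAdd (v q (a p)) = 0
    · exact .inl hq
    · refine .inr (hb' p q (Finset.mem_union_right _ (Finset.mem_biUnion.mpr ⟨p, hp, ?_⟩)) hqp)
      simpa using hq
  · intro q hq hqp
    rw [map_zpow, map_zpow, MonoidHom.zpow_apply, h0 (a p) (b q) fun r ↦ ?_, one_zpow, one_zpow]
    by_cases hr : toAdd (v r (a p)) = 0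
    · exact .inl hr
    · refine .inr ?_
      by_cases hrq : r = q
      · subst hrq
        exact (hr (ha' p r hq hqp)).elim
      · refine hb' q r (Finset.mem_union_right _ (Finset.mem_biUnion.mpr ⟨p, hp, ?_⟩)) hrq
        simpa using hr
  · exact fun h ↦ (h hp).elim

end Symbols

/-! ### Steinberg symbols: removing the local constants -/

section Steinberg

open Multiplicative

variable {F C P : Type*} [Field F] [CommGroup C] {v : P → Fˣ →* Multiplicative ℤ}
  {φ : Fˣ →* Fˣ →* C}

/-- A Steinberg symbol on a field with valuations satisfying approximation is trivial if it is
trivial on elements with disjoint supports. -/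
theorem symbol_eq_one
    (h0 : ∀ f g, (∀ p, toAdd (v p f) = 0 ∨ toAdd (v p g) = 0) → φ f g = 1)
    (fin : ∀ f : Fˣ, {p | toAdd (v p f) ≠ 0}.Finite)
    (approx : ∀ (S : Finset P) (n : P → ℤ), ∃ f : Fˣ, ∀ p ∈ S, toAdd (v p f) = n p)
    (swap : ∀ f g, φ f g * φ g f = 1)
    (steinberg : ∀ f g : Fˣ, (f : F) + g = 1 → φ f g = 1)
    (hneg : ∀ p (f g : Fˣ), (f : F) + g = 1 → toAdd (v p f) < 0 →
      toAdd (v p g) = toAdd (v p f))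
    (hpos : ∀ p (f g : Fˣ), (f : F) + g = 1 → 0 < toAdd (v p f) → toAdd (v p g) = 0)
    (f g : Fˣ) : φ f g = 1 := by
  classical
  obtain ⟨Λ, hΛ, hex, hprod⟩ := exists_symbol_eq_prod h0 fin approx
  have hsq (p : P) : Λ p * Λ p = 1 := by
    obtain ⟨a, b, hab⟩ := hex p
    -- Being a pair is symmetric, so `Λ p` is both `φ a b` and `φ b a`, whose product is 1.
    have hba : IsPairAt v p b a := ⟨hab.2.1, hab.1, fun q hq ↦ (hab.2.2 q hq).symm⟩
    nth_rw 1 [hΛ p a b hab]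
    rw [hΛ p b a hba, swap]
  have hone (p : P) : Λ p = 1 := by
    obtain ⟨x, hx⟩ := approx {p} (fun _ ↦ -1)
    simp only [Finset.mem_singleton, forall_eq] at hx
    -- Let `x` have a simple pole at `p`. The factor `h ^ 2` raises any other nonzero order n of `x`
    -- to n + 2|n| ≥ 0, so away from `p` the poles of `y = x * h ^ 2` come from `h ^ 2` alone and
    -- are of even order.
    obtain ⟨h, hh⟩ := approx (insert p (fin x).toFinset)
      (fun q ↦ if q = p then 0 else |toAdd (v q x)|)
    have hhp : toAdd (v p h) = 0 := by rw [hh p (by simp), if_pos rfl]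
    have hhq (q : P) (hq : toAdd (v q x) ≠ 0) (hqp : q ≠ p) :
        toAdd (v q h) = |toAdd (v q x)| := by
      rw [hh q (by simp [-toAdd_eq_zero, hq]), if_neg hqp]
    set y : Fˣ := x * h ^ 2 with hy
    have hvy (q : P) : toAdd (v q y) = toAdd (v q x) + 2 * toAdd (v q h) := by
      rw [hy, map_mul, map_pow, toAdd_mul, toAdd_pow]; simp
    have hyp : toAdd (v p y) = -1 := by rw [hvy, hx, hhp]; simp
    have hy1 : (1 : F) - y ≠ 0 := by
      intro hcon
      have : y = 1 := Units.ext (sub_eq_zero.mp hcon).symm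
      rw [this, map_one] at hyp
      simp at hyp
    set z : Fˣ := Units.mk0 _ hy1
    have hyz : (y : F) + z = 1 := by simp [z]
    have hst := steinberg y z hyz
    rw [hprod y z (insert p ((fin y).toFinset ∪ (fin z).toFinset)) (fun q hq ↦ by simp [-toAdd_eq_zero, hq])
      (fun q hq ↦ by simp [-toAdd_eq_zero, hq]), Finset.prod_eq_single p] at hst
    -- At a pole `y` and `z = 1 - y` have equal orders; at `p` the exponent of `Λ p` is (-1)(-1) =
    -- 1.
    · rwa [hneg p y z hyz (by omega), hyp, neg_mul_neg, one_mul, zpow_one] at hst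
    · intro q _ hqp
      rcases lt_trichotomy (toAdd (v q y)) 0 with hlt | heq | hgt
      · rw [hneg q y z hyz hlt]
        have hqx : toAdd (v q x) = 0 := by
          by_contra hcon
          rw [hvy, hhq q hcon hqp] at hlt
          have := neg_abs_le (toAdd (v q x))
          have := abs_nonneg (toAdd (v q x))
          omega
        rw [hvy, hqx, zero_add, mul_assoc, zpow_mul, zpow_ofNat, pow_two, hsq, one_zpow]
      · rw [heq, zero_mul, zpow_zero]
      · rw [hpos q y z hyz hgt, mul_zero, zpow_zero]
    · intro hcon
      simp at hcon
  rw [hprod f g ((fin f).toFinset ∪ (fin g).toFinset) (fun q hq ↦ by simp [-toAdd_eq_zero, hq])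
      (fun q hq ↦ by simp [-toAdd_eq_zero, hq])]
  exact Finset.prod_eq_one fun p _ ↦ by rw [hone, one_zpow]

end Steinberg

/-! ### Weak approximation -/

section Approximation

variable {F P : Type*} [Field F] (O : P → Type*) [∀ p, CommRing (O p)] [∀ p, IsDomain (O p)]
  [∀ p, IsDiscreteValuationRing (O p)] [∀ p, Algebra (O p) F] [∀ p, IsFractionRing (O p) F]

/-- The bound 2 makes the `N`-th power of an element vanishing at a place vanish there more than a
uniformizer; the other bounds make `N`-th powers of elements with poles dominate given pole orders.
-/
theorem exists_nat_gt_neg (S : Finset P) (n : P → ℤ) :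
    ∃ N : ℕ, 2 ≤ N ∧ ∀ s ∈ S, -n s < N := by
  refine ⟨2 + ∑ s ∈ S, (n s).natAbs, by omega, fun s hs ↦ ?_⟩
  have : (n s).natAbs ≤ ∑ s ∈ S, (n s).natAbs :=
    Finset.single_le_sum (f := fun s ↦ (n s).natAbs) (fun _ _ ↦ Nat.zero_le _) hs
  omega

theorem natCast_mul_le_neg {N : ℕ} {n : ℤ} (hn : n < 0) : (N : ℤ) * n ≤ -N := by
  nlinarith [Int.natCast_nonneg N]

-- Induction on `S`. If `y` is not yet negative at the new point `q`, add a high power of `z`, which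
-- is positive at `p` and negative at `q`. At each point of the enlarged set the two summands have
-- different orders: the power wins where `z` has a pole, and `y` wins elsewhere.
variable {O} in
theorem exists_ordv_pos_of_not_le
    (hO : ∀ p q, Set.range (algebraMap (O p) F) ⊆ Set.range (algebraMap (O q) F) → p = q)
    (p : P) (S : Finset P) (hp : p ∉ S) :
    ∃ y : F, y ≠ 0 ∧ 0 < ordv (O p) y ∧ ∀ q ∈ S, ordv (O q) y < 0 := by
  classical
  have hout {q r : P} (h : q ≠ r) : ∃ x : F, x ≠ 0 ∧ 0 ≤ ordv (O q) x ∧ ordv (O r) x < 0 := by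
    have := mt (hO q r) h
    rw [Set.not_subset] at this
    obtain ⟨x, hx, hx'⟩ := this
    have hx0 : x ≠ 0 := by rintro rfl; exact hx' ⟨0, map_zero _⟩
    exact ⟨x, hx0, (ordv_nonneg_iff _ hx0).mpr hx, not_le.mp (mt (ordv_nonneg_iff _ hx0).mp hx')⟩
  induction S using Finset.induction_on with
  | empty =>
    obtain ⟨x, hx, hx'⟩ := exists_ordv_eq_one (O p) F
    exact ⟨x, hx, by omega, by simp⟩
  | insert q S hq ih =>
    rw [Finset.mem_insert, not_or] at hp
    obtain ⟨y, hy0, hyp, hyS⟩ := ih hp.2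
    rcases lt_or_ge (ordv (O q) y) 0 with hyq | hyq
    · exact ⟨y, hy0, hyp, by simpa using ⟨hyq, hyS⟩⟩
    obtain ⟨a, ha0, hap, haq⟩ := hout hp.1
    obtain ⟨b, hb0, hbq, hbp⟩ := hout (Ne.symm hp.1)
    have hz0 : a / b ≠ 0 := div_ne_zero ha0 hb0
    have hzp : 0 < ordv (O p) (a / b) := by rw [ordv_div _ ha0 hb0]; omega
    have hzq : ordv (O q) (a / b) < 0 := by rw [ordv_div _ ha0 hb0]; omega
    generalize a / b = z at hz0 hzp hzq
    obtain ⟨M, hM, hMS⟩ := exists_nat_gt_neg S (fun s ↦ ordv (O s) y)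
    have hM0 : 0 < (M : ℤ) := by omega
    have hzM := pow_ne_zero M hz0
    have hzqM := natCast_mul_le_neg (N := M) hzq
    have hsumq := ordv_add_of_lt (O q) hzM hy0 (by rw [ordv_pow _ hz0]; omega)
    refine ⟨z ^ M + y, hsumq.1, ?_, ?_⟩
    · refine lt_of_lt_of_le ?_ (ordv_add (O p) hsumq.1 hzM hy0)
      rw [lt_min_iff, ordv_pow _ hz0]
      exact ⟨by positivity, hyp⟩
    · intro s hs
      rw [Finset.mem_insert] at hs
      rcases hs with rfl | hs
      · rw [hsumq.2, ordv_pow _ hz0]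
        omega
      · have hys := hyS s hs
        have hMs := hMS s hs
        rcases lt_or_ge (ordv (O s) z) 0 with hzs | hzs
        · have hzsM := natCast_mul_le_neg (N := M) hzs
          rw [(ordv_add_of_lt (O s) hzM hy0 (by rw [ordv_pow _ hz0]; omega)).2, ordv_pow _ hz0]
          omega
        · have hzsM : 0 ≤ M * ordv (O s) z := by positivity
          rw [add_comm, (ordv_add_of_lt (O s) hy0 hzM (by rw [ordv_pow _ hz0]; omega)).2]
          exact hys

-- Take `w` of order at least two at `p` and with large poles along `S`. Then `(ϖ + w) / (1 + w)`
-- behaves like `ϖ` at `p` and like `w / w` on `S`.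
variable {O} in
theorem exists_ordv_eq_one_and_eq_zero
    (hO : ∀ p q, Set.range (algebraMap (O p) F) ⊆ Set.range (algebraMap (O q) F) → p = q)
    (p : P) (S : Finset P) (hp : p ∉ S) :
    ∃ x : F, x ≠ 0 ∧ ordv (O p) x = 1 ∧ ∀ q ∈ S, ordv (O q) x = 0 := by
  obtain ⟨y, hy0, hyp, hyS⟩ := exists_ordv_pos_of_not_le hO p S hp
  obtain ⟨ϖ, hϖ0, hϖ⟩ := exists_ordv_eq_one (O p) F
  obtain ⟨N, hN, hNS⟩ := exists_nat_gt_neg S (fun s ↦ ordv (O s) ϖ)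
  have hw0 := pow_ne_zero N hy0
  have hwp : 2 ≤ ordv (O p) (y ^ N) := by
    have : (2 : ℤ) * 1 ≤ N * ordv (O p) y := mul_le_mul (by omega) (by omega) (by omega) (by omega)
    rwa [ordv_pow _ hy0]
  have hwS (s) (hs : s ∈ S) : ordv (O s) (y ^ N) ≤ -N := by
    rw [ordv_pow _ hy0]
    exact natCast_mul_le_neg (hyS s hs)
  generalize y ^ N = w at hw0 hwp hwS
  have h1p := ordv_add_of_lt (O p) one_ne_zero hw0 (by rw [ordv_one]; omega)
  have hnum := ordv_add_of_lt (O p) hϖ0 hw0 (by rw [hϖ]; omega)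
  refine ⟨(ϖ + w) / (1 + w), div_ne_zero hnum.1 h1p.1, ?_, fun q hq ↦ ?_⟩
  · rw [ordv_div _ hnum.1 h1p.1, hnum.2, h1p.2, hϖ, ordv_one, sub_zero]
  · have h1 := hNS q hq
    have h2 := hwS q hq
    have h3 : (2 : ℤ) ≤ N := by exact_mod_cast hN
    have h1q := ordv_add_of_lt (O q) hw0 one_ne_zero (by rw [ordv_one]; omega)
    have h2q := ordv_add_of_lt (O q) hw0 hϖ0 (by omega)
    rw [ordv_div _ hnum.1 h1p.1, add_comm ϖ, add_comm 1, h1q.2, h2q.2, sub_self]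

variable {O} in
/-- Weak approximation for orders. -/
theorem exists_ordv_eq
    (hO : ∀ p q, Set.range (algebraMap (O p) F) ⊆ Set.range (algebraMap (O q) F) → p = q)
    (S : Finset P) (n : P → ℤ) :
    ∃ x : Fˣ, ∀ p ∈ S, ordv (O p) (x : F) = n p := by
  classical
  have (p : P) := exists_ordv_eq_one_and_eq_zero hO p (S.erase p) (by simp)
  choose x hx0 hxp hxS using this
  have key (q : P) (hq : q ∈ S) (T : Finset P) (hT : T ⊆ S) :
      ordv (O q) (((∏ p ∈ T, Units.mk0 (x p) (hx0 p) ^ n p : Fˣ)) : F) =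
        if q ∈ T then n q else 0 := by
    induction T using Finset.induction_on with
    | empty => simp
    | insert p T hp ih =>
      rw [Finset.prod_insert hp, Units.val_mul, ordv_mul _ (Units.ne_zero _) (Units.ne_zero _),
        ih ((Finset.subset_insert _ _).trans hT), Units.val_zpow_eq_zpow_val, Units.val_mk0,
        ordv_zpow _ (hx0 p)]
      by_cases hpq : q = p
      · subst hpq
        simp [hp, hxp]
      · rw [hxS p q (by simp [hq, hpq])]
        simp [hpq]
  exact ⟨_, fun q hq ↦ (key q hq S subset_rfl).trans (if_pos hq)⟩

end Approximation

/-- An element of `F` is integral over `A` if and only if it belongs to all valuation rings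
which contain `A`. -/
theorem mem_integralClosure_iff {A F : Type*} [CommRing A] [Field F] [Algebra A F] {x : F} :
    x ∈ integralClosure A F ↔
    ∀ V : ValuationSubring F, (∀ q : A, algebraMap A F q ∈ V) → x ∈ V := by
  refine ⟨fun hx V hV ↦ ?_, fun h ↦ ?_⟩
  · let : Algebra A V := ((algebraMap A F).codRestrict V.toSubring hV).toAlgebra
    have : IsScalarTower A V F := .of_algebraMap_eq fun _ ↦ rfl
    obtain ⟨y, hy⟩ := IsIntegrallyClosed.isIntegral_iff.mp (IsIntegral.tower_top (A := V) hx)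
    exact hy ▸ y.2
  · by_contra hx
    have : IsIntegrallyClosedIn (integralClosure A F).toSubring F :=
      inferInstanceAs (IsIntegrallyClosedIn (integralClosure A F) F)
    obtain ⟨V, hV, hxV⟩ := Subring.exists_le_valuationSubring_of_isIntegrallyClosedIn
      (R := (integralClosure A F).toSubring) hx
    exact hxV (h V fun q ↦ hV ((integralClosure A F).algebraMap_mem q))

/-! ### Places of a function field and the integral closure of k[X] -/

section Places

open IsLocalRing Polynomial

variable (k : Type*) {F P : Type*} [Field k] [Field F] [Algebra k F] (O : P → Type*)
  [∀ p, CommRing (O p)] [∀ p, IsDomain (O p)] [∀ p, IsDiscreteValuationRing (O p)]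
  [∀ p, Algebra (O p) F] [∀ p, IsFractionRing (O p) F] [∀ p, Algebra k (O p)]
  [∀ p, IsScalarTower k (O p) F]

variable (F) in
/-- The family of discrete valuation rings `O p` consists of all nontrivial valuation rings of
`F / k`, without repetition; their residue fields are finite over `k`, and their elements belong to
finitely generated integrally closed `k`-subalgebras contained in them. -/
structure IsCompletePlaces : Prop where
  finite_residueField : ∀ p, Module.Finite k (ResidueField (O p))
  eq_of_subset : ∀ p q,
    Set.range (algebraMap (O p) F) ⊆ Set.range (algebraMap (O q) F) → p = q
  exists_eq : ∀ V : ValuationSubring F, (∀ c : k, algebraMap k F c ∈ V) → V ≠ ⊤ →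
    ∃ p, ∀ x, x ∈ V ↔ ∃ a : O p, algebraMap (O p) F a = x
  exists_subalgebra : ∀ p (t : O p), ∃ S : Subalgebra k F, S.FG ∧ algebraMap (O p) F t ∈ S ∧
    (∀ x ∈ S, ∃ a : O p, algebraMap (O p) F a = x) ∧ ∀ x : F, IsIntegral S x → x ∈ S

variable {k O}
variable [Algebra k[X] F]

variable [IsScalarTower k k[X] F]

/-- If `x` were transcendental over `K = k(X)`, some valuation ring containing `K` would have `x` as
a nonunit, hence be a place. There `X` has residue algebraic over `k`, so a nonzero polynomial in
`X` is a nonunit, although nonzero elements of `K` are units. -/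
theorem isAlgebraic_of_isCompletePlaces [FaithfulSMul k[X] F] (h : IsCompletePlaces k F O) (x : F) :
    IsAlgebraic k[X] x := by
  by_contra hx
  let := FractionRing.liftAlgebra k[X] F
  set K := FractionRing k[X]
  have hxK : ¬ IsAlgebraic K x := fun hcon ↦ hx ((IsFractionRing.isAlgebraic_iff k[X] K F).mpr hcon)
  have hx0 : x ≠ 0 := by rintro rfl; exact hxK isAlgebraic_zero
  let A : Subalgebra K F := Algebra.adjoin K {x}
  let y : A.toSubring := ⟨x, Algebra.subset_adjoin rfl⟩
  have hI : Ideal.span {y} ≠ ⊤ := by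
    intro htop
    rw [Ideal.eq_top_iff_one, Ideal.mem_span_singleton'] at htop
    obtain ⟨⟨z, hz⟩, hzy⟩ := htop
    have hzy' : z * x = 1 := congr_arg Subtype.val hzy
    obtain ⟨q, hq⟩ := (Algebra.adjoin_singleton_eq_range_aeval K x).le hz
    refine hxK ⟨q * X - 1, fun h0 ↦ ?_, ?_⟩
    · have := congr_arg (Polynomial.eval 0) h0
      simp at this
    · have hq' : aeval x q = z := hq
      simp [hq', hzy']
  obtain ⟨V, hV, hIV⟩ := Ideal.image_subset_nonunits_valuationSubring _ hI
  have hxV : x ∈ V.nonunits := hIV ⟨y, Ideal.subset_span rfl, rfl⟩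
  have hKV (c : K) : algebraMap K F c ∈ V := hV (A.algebraMap_mem c)
  obtain ⟨p, hp⟩ := h.exists_eq V
    (fun c ↦ by
      rw [IsScalarTower.algebraMap_apply k k[X] F, IsScalarTower.algebraMap_apply k[X] K F]
      exact hKV _)
    (by
      rintro rfl
      rw [ValuationSubring.mem_nonunits_iff_exists_mem_maximalIdeal] at hxV
      obtain ⟨hx1, hx2⟩ := hxV
      refine hx2 (IsUnit.of_mul_eq_one ⟨x⁻¹, trivial⟩ (Subtype.ext ?_))
      exact mul_inv_cancel₀ hx0)
  have := h.finite_residueField p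
  obtain ⟨a, ha⟩ := (hp (algebraMap k[X] F X)).mp (by
    rw [IsScalarTower.algebraMap_apply k[X] K F]; exact hKV _)
  obtain ⟨q, hq0, hq⟩ := Algebra.IsAlgebraic.isAlgebraic (R := k) (residue (O p) a)
  have hqa : aeval (algebraMap k[X] F X) q = algebraMap k[X] F q := by
    rw [aeval_algebraMap_apply, aeval_X_left_apply]
  have hqm : aeval a q ∈ maximalIdeal (O p) := by
    rw [← residue_eq_zero_iff, ← hq]
    exact (aeval_algebraMap_apply (ResidueField (O p)) a q).symm
  have hqF : algebraMap (O p) F (aeval a q) = algebraMap k[X] F q := by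
    rw [← aeval_algebraMap_apply, ha, hqa]
  obtain ⟨b, hb⟩ := (hp (algebraMap k[X] F q)⁻¹).mp (by
    rw [IsScalarTower.algebraMap_apply k[X] K F, ← map_inv₀]; exact hKV _)
  refine hqm (IsUnit.of_mul_eq_one b (IsFractionRing.injective (O p) F ?_))
  rw [map_mul, hqF, hb, map_one, mul_inv_cancel₀]
  simpa using hq0

variable (k F O) in
/-- The places of `F` which are finite with respect to `X`. -/
abbrev FinitePlace : Type _ := {p : P // ∃ a : O p, algebraMap (O p) F a = algebraMap k[X] F X}

theorem exists_algebraMap_eq_of_mem_integralClosure (p : FinitePlace k F O)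
    (x : integralClosure k[X] F) : ∃ a : O p.1, algebraMap (O p.1) F a = x := by
  obtain ⟨p, a, ha⟩ := p
  let : Algebra k[X] (O p) := (aeval (R := k) a).toAlgebra
  have : IsScalarTower k[X] (O p) F := .of_algebraMap_eq fun q ↦ by
    change _ = algebraMap (O p) F (aeval a q)
    rw [← aeval_algebraMap_apply, ha, aeval_algebraMap_apply, aeval_X_left_apply]
  exact IsIntegrallyClosed.isIntegral_iff.mp (IsIntegral.tower_top (A := O p) x.2)

/-- The inclusion of the integral closure of `k[X]` into the valuation ring of a finite place. -/
noncomputable def toPlace (p : FinitePlace k F O) : integralClosure k[X] F →+* O p.1 where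
  toFun x := (exists_algebraMap_eq_of_mem_integralClosure p x).choose
  map_one' := IsFractionRing.injective (O p.1) F <| by
    rw [(exists_algebraMap_eq_of_mem_integralClosure p _).choose_spec]; simp
  map_zero' := IsFractionRing.injective (O p.1) F <| by
    rw [(exists_algebraMap_eq_of_mem_integralClosure p _).choose_spec]; simp
  map_mul' x y := IsFractionRing.injective (O p.1) F <| by
    rw [map_mul, (exists_algebraMap_eq_of_mem_integralClosure p _).choose_spec,
      (exists_algebraMap_eq_of_mem_integralClosure p _).choose_spec,
      (exists_algebraMap_eq_of_mem_integralClosure p _).choose_spec]; simp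
  map_add' x y := IsFractionRing.injective (O p.1) F <| by
    rw [map_add, (exists_algebraMap_eq_of_mem_integralClosure p _).choose_spec,
      (exists_algebraMap_eq_of_mem_integralClosure p _).choose_spec,
      (exists_algebraMap_eq_of_mem_integralClosure p _).choose_spec]; simp

@[simp]
theorem algebraMap_toPlace (p : FinitePlace k F O) (x : integralClosure k[X] F) :
    algebraMap (O p.1) F (toPlace p x) = x :=
  (exists_algebraMap_eq_of_mem_integralClosure p x).choose_spec

theorem toPlace_injective (p : FinitePlace k F O) : Function.Injective (toPlace p) :=
  fun x y hxy ↦ Subtype.ext (by rw [← algebraMap_toPlace p, hxy, algebraMap_toPlace])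

theorem toPlace_algebraMap (p : FinitePlace k F O) (c : k) :
    toPlace p (algebraMap k _ c) = algebraMap k (O p.1) c := by
  refine IsFractionRing.injective (O p.1) F ?_
  rw [algebraMap_toPlace, ← IsScalarTower.algebraMap_apply k (O p.1) F]
  rfl

/-- The center of a finite place on the integral closure of `k[X]`. -/
noncomputable def center (p : FinitePlace k F O) : Ideal (integralClosure k[X] F) :=
  (maximalIdeal (O p.1)).comap (toPlace p)

instance (p : FinitePlace k F O) : (center p).IsPrime := by
  unfold center; infer_instance

theorem mem_center_iff (p : FinitePlace k F O) {x : integralClosure k[X] F} :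
    x ∈ center p ↔ toPlace p x ∈ maximalIdeal (O p.1) := Iff.rfl

/-- This exhibits `O p` as a localization of the integral closure R before R is known to be finite.
Let `y` be a root of a primitive `Q` with coefficients q_j. The Horner tails b_j = Σ q_{i+j} y^i lie
in R and satisfy b_j = b_{j+1} y + q_j, so any b_{j+1} outside the center is a denominator for `y`.
If none were, every coefficient of `Q` would lie in a single prime of k[X]. -/
theorem exists_mul_mem_integralClosure [FaithfulSMul k[X] F] (h : IsCompletePlaces k F O) (p : FinitePlace k F O)
    (x : O p.1) : ∃ s r : integralClosure k[X] F, s ∉ center p ∧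
      algebraMap (O p.1) F x * s = r := by
  classical
  obtain ⟨Q₀, hQ₀, hQx₀⟩ := isAlgebraic_of_isCompletePlaces h (algebraMap (O p.1) F x)
  let := UniqueFactorizationMonoid.toNormalizedGCDMonoid k[X]
  obtain ⟨Q, hQ, hQx⟩ : ∃ Q : k[X][X], Q.IsPrimitive ∧ aeval (algebraMap (O p.1) F x) Q = 0 :=
    ⟨Q₀.primPart, Q₀.isPrimitive_primPart, aeval_primPart_eq_zero hQ₀ hQx₀⟩
  set y := algebraMap (O p.1) F x with hy
  let b (j : ℕ) : F := aeval y (divX^[j] Q)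
  have hcoeff (j : ℕ) : (divX^[j] Q).coeff 0 = Q.coeff j := by
    suffices ∀ i, (divX^[j] Q).coeff i = Q.coeff (i + j) by simpa using this 0
    induction j with
    | zero => simp
    | succ j ih => intro i; rw [Function.iterate_succ_apply', coeff_divX, ih]; congr 1; ring
  have hb (j : ℕ) : b j = b (j + 1) * y + algebraMap k[X] F (Q.coeff j) := by
    simp only [b]
    rw [Function.iterate_succ_apply']
    conv_lhs => rw [← divX_mul_X_add (divX^[j] Q)]
    rw [map_add, map_mul, aeval_X, aeval_C, hcoeff]
  have hb0 : b 0 = 0 := hQx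
  have hbR (j : ℕ) : b j ∈ integralClosure k[X] F := by
    rw [mem_integralClosure_iff]
    intro V hV
    rcases V.mem_or_inv_mem y with hyV | hyV
    · simp only [b, aeval_eq_sum_range]
      refine sum_mem fun i _ ↦ ?_
      rw [Algebra.smul_def]
      exact mul_mem (hV _) (pow_mem hyV _)
    -- If `y⁻¹` is in `V`, membership climbs from `b 0 = 0` by b_{j+1} = (b_j - q_j) y⁻¹.
    · induction j with
      | zero => rw [hb0]; exact zero_mem _
      | succ j ih =>
        rcases eq_or_ne y 0 with hy0 | hy0
        · simp only [b, aeval_eq_sum_range]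
          refine sum_mem fun i _ ↦ ?_
          rw [Algebra.smul_def]
          exact mul_mem (hV _) (pow_mem (hy0 ▸ zero_mem _) _)
        · have : b (j + 1) = (b j - algebraMap k[X] F (Q.coeff j)) * y⁻¹ := by
            rw [hb j, add_sub_cancel_right, mul_inv_cancel_right₀ hy0]
          rw [this]
          exact mul_mem (sub_mem ih (hV _)) hyV
  let B (j : ℕ) : integralClosure k[X] F := ⟨b j, hbR j⟩
  by_cases hex : ∃ j, B (j + 1) ∉ center p
  · obtain ⟨j, hj⟩ := hex
    refine ⟨B (j + 1), B j - algebraMap k[X] _ (Q.coeff j), hj, ?_⟩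
    change y * b (j + 1) = b j - algebraMap k[X] F (Q.coeff j)
    rw [hb j, add_sub_cancel_right, mul_comm]
  · push Not at hex
    exfalso
    let 𝔮 : Ideal k[X] := (center p).comap (algebraMap k[X] (integralClosure k[X] F))
    have hmem (j : ℕ) : Q.coeff j ∈ 𝔮 := by
      have h1 : toPlace p (B j) = toPlace p (B (j + 1)) * x +
          toPlace p (algebraMap k[X] _ (Q.coeff j)) := by
        refine IsFractionRing.injective (O p.1) F ?_
        rw [map_add, map_mul, algebraMap_toPlace, algebraMap_toPlace, algebraMap_toPlace]
        exact hb j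
      have h2 : toPlace p (B j) ∈ maximalIdeal (O p.1) := by
        rcases j with _ | j
        · have : B 0 = 0 := Subtype.ext hb0
          rw [this, map_zero]; exact zero_mem _
        · exact hex j
      rw [Ideal.mem_comap, mem_center_iff]
      rw [eq_sub_of_add_eq' h1.symm]
      exact sub_mem h2 (Ideal.mul_mem_right _ _ (hex j))
    -- The generator of `𝔮` is a common divisor of the coefficients, hence a unit by primitivity.
    have hdvd : C (Submodule.IsPrincipal.generator 𝔮) ∣ Q := by
      rw [C_dvd_iff_dvd_coeff]
      exact fun i ↦ (Submodule.IsPrincipal.mem_iff_generator_dvd 𝔮).mp (hmem i)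
    have hu := hQ _ hdvd
    have : 𝔮 = ⊤ := Ideal.eq_top_of_isUnit_mem _ (Submodule.IsPrincipal.generator_mem 𝔮) hu
    exact (inferInstance : 𝔮.IsPrime).ne_top this

end Places

/-! ### Finite places are the maximal ideals of a Dedekind domain -/

section FinitePlaces

open IsLocalRing Polynomial

theorem not_isField_integralClosure {k F : Type*} [Field k] [Field F] [Algebra k[X] F] [FaithfulSMul k[X] F] :
    ¬ IsField (integralClosure k[X] F) := by
  intro hf
  refine Polynomial.not_isField k ?_
  exact isField_of_isIntegral_of_isField (R := k[X]) (S := integralClosure k[X] F)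
    (FaithfulSMul.algebraMap_injective _ _) hf

variable {k F P : Type*} [Field k] [Field F] [Algebra k F] {O : P → Type*}
  [∀ p, CommRing (O p)] [∀ p, IsDomain (O p)] [∀ p, IsDiscreteValuationRing (O p)]
  [∀ p, Algebra (O p) F] [∀ p, IsFractionRing (O p) F] [∀ p, Algebra k (O p)]
  [∀ p, IsScalarTower k (O p) F]
  [Algebra k[X] F] [IsScalarTower k k[X] F] [FaithfulSMul k[X] F]

theorem isFractionRing_integralClosure (h : IsCompletePlaces k F O) :
    IsFractionRing (integralClosure k[X] F) F :=
  have : Algebra.IsAlgebraic k[X] F := ⟨isAlgebraic_of_isCompletePlaces h⟩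
  integralClosure.isFractionRing_of_algebraic fun x hx ↦ by simpa using hx

theorem isIntegrallyClosed_integralClosure (h : IsCompletePlaces k F O) :
    IsIntegrallyClosed (integralClosure k[X] F) := by
  have := isFractionRing_integralClosure h
  rw [isIntegrallyClosed_iff_isIntegrallyClosedIn F]
  infer_instance

/-- Otherwise every nonzero element of the integral closure, and hence of its fraction field `F`,
would have order zero at `p`. -/
theorem center_ne_bot (h : IsCompletePlaces k F O) (p : FinitePlace k F O) : center p ≠ ⊥ := by
  intro hbot
  have := isFractionRing_integralClosure h
  obtain ⟨x, hx0, hx⟩ := exists_ordv_eq_one (O p.1) F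
  obtain ⟨a, b, hb, hab⟩ := IsFractionRing.div_surjective (A := integralClosure k[X] F) x
  have hb0 : b ≠ 0 := nonZeroDivisors.ne_zero hb
  have ha0 : a ≠ 0 := by
    rintro rfl
    rw [map_zero, zero_div] at hab
    exact hx0 hab.symm
  have key (c : integralClosure k[X] F) (hc : c ≠ 0) :
      ordv (O p.1) (algebraMap (integralClosure k[X] F) F c) = 0 := by
    have h1 : c ∉ center p := by rwa [hbot]
    have h2 : IsUnit (toPlace p c) := by
      by_contra hcon; exact h1 hcon
    have h3 := (ordv_algebraMap_eq_zero_iff (F := F) (O p.1) h2.ne_zero).mpr h2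
    rwa [algebraMap_toPlace] at h3
  have h0 (c : integralClosure k[X] F) (hc : c ≠ 0) : algebraMap (integralClosure k[X] F) F c ≠ 0 :=
    by simpa using hc
  rw [← hab, ordv_div _ (h0 a ha0) (h0 b hb0), key a ha0, key b hb0] at hx
  omega

theorem center_isMaximal (h : IsCompletePlaces k F O) (p : FinitePlace k F O) :
    (center p).IsMaximal :=
  Ring.DimensionLEOne.maximalOfPrime (center_ne_bot h p) inferInstance

/-- A valuation ring dominating the integral closure at `M` is not all of `F`, since `M ≠ ⊥`; so it
is a place. -/
theorem exists_center_eq (h : IsCompletePlaces k F O) (M : Ideal (integralClosure k[X] F))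
    [hM : M.IsMaximal] : ∃ p : FinitePlace k F O, center p = M := by
  obtain ⟨V, hV, hMV⟩ := Ideal.image_subset_nonunits_valuationSubring
    (A := (integralClosure k[X] F).toSubring) M hM.ne_top
  have hAV (q : k[X]) : algebraMap k[X] F q ∈ V := hV ((integralClosure k[X] F).algebraMap_mem q)
  obtain ⟨p, hp⟩ := h.exists_eq V
    (fun c ↦ by rw [IsScalarTower.algebraMap_apply k k[X] F]; exact hAV _)
    (by
      rintro rfl
      have hM0 : M ≠ ⊥ := Ring.ne_bot_of_isMaximal_of_not_isField hM not_isField_integralClosure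
      obtain ⟨x, hxM, hx0⟩ := Submodule.exists_mem_ne_zero_of_ne_bot hM0
      have hx := hMV ⟨x, hxM, rfl⟩
      rw [SetLike.mem_coe, ValuationSubring.mem_nonunits_iff_exists_mem_maximalIdeal] at hx
      obtain ⟨hx1, hx2⟩ := hx
      refine hx2 (IsUnit.of_mul_eq_one ⟨(x : F)⁻¹, trivial⟩ (Subtype.ext ?_))
      exact mul_inv_cancel₀ fun h0 ↦ hx0 (Subtype.ext h0))
  obtain ⟨p', hp'⟩ : ∃ p' : FinitePlace k F O, p'.1 = p := ⟨⟨p, (hp _).mp (hAV X)⟩, rfl⟩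
  subst hp'
  refine ⟨p', (hM.eq_of_le (inferInstance : (center p').IsPrime).ne_top fun x hx ↦ ?_).symm⟩
  rw [mem_center_iff]
  have hxV := hMV ⟨x, hx, rfl⟩
  rw [SetLike.mem_coe, ValuationSubring.mem_nonunits_iff_exists_mem_maximalIdeal] at hxV
  obtain ⟨hx1, hx2⟩ := hxV
  intro hu
  refine hx2 ?_
  obtain ⟨y, hy⟩ := hu.exists_right_inv
  refine IsUnit.of_mul_eq_one ⟨algebraMap (O p'.1) F y, (hp _).mpr ⟨y, rfl⟩⟩ (Subtype.ext ?_)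
  have := congr_arg (algebraMap (O p'.1) F) hy
  rw [map_mul, map_one] at this
  rw [algebraMap_toPlace] at this
  exact this

/-- Fractions with denominator outside the center fill the valuation ring, so equal centers give an
inclusion of valuation rings. -/
theorem center_injective (h : IsCompletePlaces k F O) :
    Function.Injective (center : FinitePlace k F O → _) := by
  intro p q hpq
  refine Subtype.ext (h.eq_of_subset _ _ ?_)
  rintro _ ⟨x, rfl⟩
  obtain ⟨s, r, hs, hsr⟩ := exists_mul_mem_integralClosure h p x
  rw [hpq, mem_center_iff] at hs
  have hu : IsUnit (toPlace q s) := by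
    by_contra hcon; exact hs hcon
  obtain ⟨y, hy⟩ := hu.exists_right_inv
  refine ⟨toPlace q r * y, ?_⟩
  have := congr_arg (algebraMap (O q.1) F) hy
  rw [map_mul, algebraMap_toPlace, map_one] at this
  rw [map_mul, algebraMap_toPlace, ← hsr, mul_assoc, this, mul_one]

/-- The integral closure R becomes finitely generated after inverting some `s` outside the center.
Indeed R lies in a finitely generated `S` contained in the valuation ring, and `s` is a common
denominator, with respect to R, of the generators of `S`. -/
theorem exists_pow_smul_mem_adjoin (h : IsCompletePlaces k F O) (p : FinitePlace k F O) :
    ∃ s ∉ center p, ∃ G : Finset (integralClosure k[X] F),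
      s ∈ Algebra.adjoin k (G : Set (integralClosure k[X] F)) ∧
      ∀ y, ∃ n : ℕ, s ^ n • y ∈ Algebra.adjoin k (G : Set (integralClosure k[X] F)) := by
  classical
  obtain ⟨t, ht⟩ := p.2
  obtain ⟨S, ⟨T, rfl⟩, htS, hSO, hSc⟩ := h.exists_subalgebra p.1 t
  set S := Algebra.adjoin k (T : Set F)
  rw [ht] at htS
  have hXS (q : k[X]) : algebraMap k[X] F q ∈ S := by
    rw [← aeval_X_left_apply (R := k) q, ← aeval_algebraMap_apply, aeval_eq_sum_range]
    exact sum_mem fun i _ ↦ S.smul_mem (pow_mem htS i) _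
  -- `S` contains k[X] and is integrally closed in `F`.
  have hRS (x : integralClosure k[X] F) : (x : F) ∈ S := by
    let : Algebra k[X] S := ((algebraMap k[X] F).codRestrict S hXS).toAlgebra
    have : IsScalarTower k[X] S F := .of_algebraMap_eq fun _ ↦ rfl
    exact hSc _ (IsIntegral.tower_top x.2)
  have hτ (τ : F) (hτ : τ ∈ S) : ∃ s r : integralClosure k[X] F, s ∉ center p ∧ τ * s = r := by
    obtain ⟨a, rfl⟩ := hSO τ hτ
    exact exists_mul_mem_integralClosure h p a
  choose! s r hs hsr using hτ
  set σ := ∏ τ ∈ T, s τ with hσ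
  have hTS (τ : F) (h : τ ∈ T) : τ ∈ S := Algebra.subset_adjoin h
  let ρ (τ : F) := r τ * ∏ τ' ∈ T.erase τ, s τ'
  have hρ (τ : F) (h : τ ∈ T) : (σ : F) * τ = ρ τ := by
    simp only [hσ, ρ, ← Finset.mul_prod_erase T s h, MulMemClass.coe_mul, ← hsr τ (hTS τ h)]
    ring
  refine ⟨σ, ?_, insert σ (T.image ρ), Algebra.subset_adjoin (by simp), fun y ↦ ?_⟩
  · rw [hσ, Ideal.IsPrime.prod_mem_iff]
    push Not
    exact fun τ hτ ↦ hs τ (hTS τ hτ)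
  set D := Algebra.adjoin k ((insert σ (T.image ρ) : Finset _) : Set (integralClosure k[X] F))
  have hσD : σ ∈ D := Algebra.subset_adjoin (by simp)
  suffices ∀ z ∈ S, ∃ n : ℕ, ∃ d ∈ D, (σ : F) ^ n * z = d by
    obtain ⟨n, d, hd, hnd⟩ := this y (hRS y)
    refine ⟨n, ?_⟩
    convert hd
    exact Subtype.ext hnd
  intro z hz
  induction hz using Algebra.adjoin_induction with
  | mem τ hτ =>
    refine ⟨1, ρ τ, Algebra.subset_adjoin ?_, by rw [pow_one, hρ τ hτ]⟩
    simp only [Finset.coe_insert, Finset.coe_image]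
    exact Or.inr ⟨τ, hτ, rfl⟩
  | algebraMap c => exact ⟨0, algebraMap k _ c, D.algebraMap_mem c, by rw [pow_zero, one_mul]; rfl⟩
  | add x y _ _ hx hy =>
    obtain ⟨m, d, hd, hmd⟩ := hx
    obtain ⟨n, e, he, hne⟩ := hy
    refine ⟨m + n, σ ^ n * d + σ ^ m * e,
      add_mem (mul_mem (pow_mem hσD _) hd) (mul_mem (pow_mem hσD _) he), ?_⟩
    push_cast
    rw [← hmd, ← hne]
    ring
  | mul x y _ _ hx hy =>
    obtain ⟨m, d, hd, hmd⟩ := hx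
    obtain ⟨n, e, he, hne⟩ := hy
    refine ⟨m + n, d * e, mul_mem hd he, ?_⟩
    push_cast
    rw [← hmd, ← hne]
    ring

/-- Finite generation is local on the spectrum: no maximal ideal contains all the elements `s` that
can be inverted as above, so finitely many of them generate the unit ideal. -/
theorem finiteType_integralClosure (h : IsCompletePlaces k F O) :
    Algebra.FiniteType k (integralClosure k[X] F) := by
  classical
  let good : Set (integralClosure k[X] F) := {s | ∃ G : Finset (integralClosure k[X] F),
    s ∈ Algebra.adjoin k (G : Set (integralClosure k[X] F)) ∧
      ∀ y, ∃ n : ℕ, s ^ n • y ∈ Algebra.adjoin k (G : Set (integralClosure k[X] F))}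
  have htop : Ideal.span good = ⊤ := by
    by_contra hne
    obtain ⟨M, hM, hle⟩ := Ideal.exists_le_maximal _ hne
    obtain ⟨p, rfl⟩ := exists_center_eq h M
    obtain ⟨s, hs, hG⟩ := exists_pow_smul_mem_adjoin h p
    exact hs (hle (Ideal.subset_span hG))
  obtain ⟨T, hT, hTtop⟩ := (Ideal.span_eq_top_iff_finite _).mp htop
  have h1 : (1 : integralClosure k[X] F) ∈ Submodule.span _ (T : Set (integralClosure k[X] F)) :=
    (Ideal.eq_top_iff_one _).mp hTtop
  obtain ⟨l, hl⟩ := (Finsupp.mem_span_iff_linearCombination _ _ _).mp h1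
  have hT' (s) (hs : s ∈ T) : ∃ G : Finset (integralClosure k[X] F),
    s ∈ Algebra.adjoin k (G : Set (integralClosure k[X] F)) ∧
      ∀ y, ∃ n : ℕ, s ^ n • y ∈ Algebra.adjoin k (G : Set (integralClosure k[X] F)) := hT hs
  choose! G hsG hG using hT'
  have hfin : (⋃ s ∈ T, (G s : Set (integralClosure k[X] F)) ∪ l '' Set.univ).Finite :=
    T.finite_toSet.biUnion fun s _ ↦ (G s).finite_toSet.union (Set.toFinite _)
  have hle (s) (hs : s ∈ T) : Algebra.adjoin k (G s : Set (integralClosure k[X] F)) ≤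
      Algebra.adjoin k (⋃ s ∈ T, (G s : Set (integralClosure k[X] F)) ∪ l '' Set.univ) :=
    Algebra.adjoin_mono fun x hx ↦ Set.mem_biUnion hs (Or.inl hx)
  refine ⟨⟨hfin.toFinset, ?_⟩⟩
  rw [hfin.coe_toFinset]
  refine top_unique fun y _ ↦ ?_
  refine Subalgebra.mem_of_span_eq_top_of_smul_pow_mem _ _ l hl (fun s hs ↦ hle s hs (hsG s hs))
    (fun i ↦ Algebra.subset_adjoin (Set.mem_biUnion i.2 (Or.inr ⟨i, trivial, rfl⟩))) y fun s ↦ ?_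
  obtain ⟨n, hn⟩ := hG s s.2 y
  exact ⟨n, hle _ s.2 hn⟩

/-- Integral and of finite type implies finite. This takes the place of the trace form, which
degenerates for inseparable extensions. -/
theorem finite_integralClosure (h : IsCompletePlaces k F O) :
    Module.Finite k[X] (integralClosure k[X] F) := by
  have := finiteType_integralClosure h
  have : Algebra.FiniteType k[X] (integralClosure k[X] F) :=
    Algebra.FiniteType.of_restrictScalars_finiteType k _ _
  exact Algebra.IsIntegral.finite

theorem isDedekindDomain_integralClosure (h : IsCompletePlaces k F O) :
    IsDedekindDomain (integralClosure k[X] F) := by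
  have := finite_integralClosure h
  have := isIntegrallyClosed_integralClosure h
  have : IsNoetherianRing (integralClosure k[X] F) :=
    IsNoetherianRing.of_finite k[X] _
  have : IsDedekindRing (integralClosure k[X] F) := { }
  exact { }

end FinitePlaces

/-! ### Norms on quotients of a Dedekind domain -/

section Determinants

theorem det_eq_det_mul_det_of_exact {k A B C : Type*} [Field k] [AddCommGroup A] [AddCommGroup B]
    [AddCommGroup C] [Module k A] [Module k B] [Module k C] [Module.Finite k B]
    {f : A →ₗ[k] B} {g : B →ₗ[k] C} (hf : Function.Injective f) (hg : Function.Surjective g)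
    (hfg : Function.Exact f g) {a : A →ₗ[k] A} {b : B →ₗ[k] B} {c : C →ₗ[k] C}
    (hab : b ∘ₗ f = f ∘ₗ a) (hbc : g ∘ₗ b = c ∘ₗ g) : b.det = a.det * c.det := by
  have hW : f.range ≤ f.range.comap b := by
    rintro _ ⟨x, rfl⟩
    exact ⟨a x, (LinearMap.congr_fun hab x).symm⟩
  rw [LinearMap.det_eq_det_mul_det f.range b hW]
  congr 1
  · rw [← LinearMap.det_conj a (LinearEquiv.ofInjective f hf)]
    congr 1
    ext ⟨_, x, rfl⟩
    have hx : (LinearEquiv.ofInjective f hf).symm ⟨f x, ⟨x, rfl⟩⟩ = x := by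
      rw [LinearEquiv.symm_apply_eq]; rfl
    simp only [LinearMap.comp_apply, LinearEquiv.coe_coe, hx]
    exact LinearMap.congr_fun hab x
  · let e : (B ⧸ f.range) ≃ₗ[k] C :=
      (Submodule.quotEquivOfEq _ _ (LinearMap.exact_iff.mp hfg).symm).trans
        (g.quotKerEquivOfSurjective hg)
    rw [← LinearMap.det_conj _ e]
    congr 1
    ext x
    obtain ⟨y, rfl⟩ := hg x
    have hy : e.symm (g y) = f.range.mkQ y := by
      rw [LinearEquiv.symm_apply_eq]; rfl
    simp only [LinearMap.comp_apply, LinearEquiv.coe_coe, hy]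
    exact LinearMap.congr_fun hbc y

variable {k R : Type*} [Field k] [CommRing R] [IsDedekindDomain R] [Algebra k R]

open UniqueFactorizationMonoid

/-- For `a` in `I` but not in `Q * I`, multiplication by `a` identifies `R ⧸ Q` with I/QI. The
resulting exact sequence from `R ⧸ Q` through `R ⧸ Q * I` to `R ⧸ I` commutes with multiplication by
`b`. -/
theorem norm_quotient_prime_mul {I Q : Ideal R} [Q.IsMaximal] (hQ : Q ≠ ⊥) (hI : I ≠ ⊥)
    [Module.Finite k (R ⧸ Q * I)] (b : R) :
    Algebra.norm k (Ideal.Quotient.mk (Q * I) b) =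
      Algebra.norm k (Ideal.Quotient.mk Q b) * Algebra.norm k (Ideal.Quotient.mk I b) := by
  have hlt : Q * I < I := by
    refine lt_of_le_of_ne Ideal.mul_le_right fun h ↦ (inferInstance : Q.IsPrime).ne_top ?_
    rw [← Ideal.one_eq_top]
    exact mul_right_cancel₀ hI (h.trans (one_mul I).symm)
  obtain ⟨a, haI, haQI⟩ := SetLike.exists_of_lt hlt
  -- The left side is `I * K` with `Q ≤ K`. Maximality leaves `K = Q`, excluded by the choice of
  -- `a`, or `K = ⊤`.
  have hspan : Ideal.span {a} ⊔ Q * I = I := by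
    have hle : Ideal.span {a} ⊔ Q * I ≤ I :=
      sup_le ((Ideal.span_singleton_le_iff_mem _).mpr haI) hlt.le
    obtain ⟨K, hK⟩ := Ideal.dvd_iff_le.mpr hle
    have hQK : Q ≤ K := by
      have h1 : Q * I ≤ I * K := hK ▸ le_sup_right
      rw [mul_comm Q, ← Ideal.dvd_iff_le] at h1
      exact Ideal.dvd_iff_le.mp ((mul_dvd_mul_iff_left hI).mp h1)
    have hQK' : K ≠ Q := by
      rintro rfl
      refine haQI ?_
      rw [mul_comm, ← hK]
      exact Ideal.mem_sup_left (Ideal.mem_span_singleton_self a)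
    have hKtop : K = ⊤ := by
      by_contra hne
      exact hQK' ((‹Q.IsMaximal›.eq_of_le hne hQK).symm)
    rw [hK, hKtop, Ideal.mul_top]
  let μ : R →ₗ[k] R ⧸ Q * I :=
    (Ideal.Quotient.mkₐ k (Q * I)).toLinearMap ∘ₗ LinearMap.mulLeft k a
  have hμ (x : R) : μ x = Ideal.Quotient.mk (Q * I) (a * x) := rfl
  have hker (x : R) : μ x = 0 ↔ x ∈ Q := by
    rw [hμ, Ideal.Quotient.eq_zero_iff_mem]
    refine ⟨fun h ↦ ?_, fun h ↦ mul_comm x a ▸ Ideal.mul_mem_mul h haI⟩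
    by_contra hx
    obtain ⟨y, q, hq, hyq⟩ := Ideal.IsMaximal.exists_inv ‹Q.IsMaximal› hx
    refine haQI ?_
    have : a = y * (a * x) + q * a := by linear_combination (-a) * hyq
    rw [this]
    exact add_mem (Ideal.mul_mem_left _ _ h) (Ideal.mul_mem_mul hq haI)
  let f : (R ⧸ Q) →ₗ[k] R ⧸ Q * I :=
    (Q.restrictScalars k).liftQ μ (fun x hx ↦ (hker x).mpr hx) ∘ₗ
      (Submodule.Quotient.restrictScalarsEquiv k Q).symm.toLinearMap
  let g : (R ⧸ Q * I) →ₗ[k] R ⧸ I := (Ideal.Quotient.factorₐ k hlt.le).toLinearMap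
  have hf (x : R) : f (Ideal.Quotient.mk Q x) = Ideal.Quotient.mk (Q * I) (a * x) := rfl
  have hg (x : R) : g (Ideal.Quotient.mk (Q * I) x) = Ideal.Quotient.mk I x := rfl
  rw [Algebra.norm_apply, Algebra.norm_apply, Algebra.norm_apply]
  refine det_eq_det_mul_det_of_exact (f := f) (g := g) ?_ ?_ ?_ ?_ ?_
  · rw [injective_iff_map_eq_zero]
    intro x hx
    obtain ⟨x, rfl⟩ := Ideal.Quotient.mk_surjective x
    rw [Ideal.Quotient.eq_zero_iff_mem]
    exact (hker x).mp hx
  · intro x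
    obtain ⟨x, rfl⟩ := Ideal.Quotient.mk_surjective x
    exact ⟨Ideal.Quotient.mk _ x, hg x⟩
  · intro x
    obtain ⟨x, rfl⟩ := Ideal.Quotient.mk_surjective x
    rw [hg, Ideal.Quotient.eq_zero_iff_mem]
    refine ⟨fun hx ↦ ?_, ?_⟩
    · rw [← hspan, Ideal.mem_span_singleton_sup] at hx
      obtain ⟨r, y, hy, rfl⟩ := hx
      refine ⟨Ideal.Quotient.mk Q r, ?_⟩
      rw [hf, Ideal.Quotient.eq, mul_comm a, sub_add_cancel_left]
      exact neg_mem hy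
    · rintro ⟨y, hy⟩
      obtain ⟨y, rfl⟩ := Ideal.Quotient.mk_surjective y
      rw [hf, Ideal.Quotient.eq] at hy
      have := sub_mem (I.mul_mem_right y haI) (hlt.le hy)
      simpa using this
  · refine LinearMap.ext fun x ↦ ?_
    obtain ⟨x, rfl⟩ := Ideal.Quotient.mk_surjective x
    change Ideal.Quotient.mk (Q * I) b * f (Ideal.Quotient.mk Q x) =
      f (Ideal.Quotient.mk Q b * Ideal.Quotient.mk Q x)
    rw [hf, ← map_mul, ← map_mul, hf, mul_left_comm]
  · refine LinearMap.ext fun x ↦ ?_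
    obtain ⟨x, rfl⟩ := Ideal.Quotient.mk_surjective x
    change g (Ideal.Quotient.mk (Q * I) b * Ideal.Quotient.mk (Q * I) x) =
      Ideal.Quotient.mk I b * g (Ideal.Quotient.mk (Q * I) x)
    rw [hg, ← map_mul, ← map_mul, hg]

theorem norm_quotient_eq_prod (hfin : ∀ I : Ideal R, I ≠ ⊥ → Module.Finite k (R ⧸ I))
    {I : Ideal R} (hI : I ≠ ⊥) (b : R) :
    Algebra.norm k (Ideal.Quotient.mk I b) =
      ((normalizedFactors I).map fun Q ↦ Algebra.norm k (Ideal.Quotient.mk Q b)).prod := by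
  induction I using UniqueFactorizationMonoid.induction_on_prime with
  | h₁ => exact (hI rfl).elim
  | h₂ I hu =>
    obtain rfl : I = ⊤ := Ideal.isUnit_iff.mp hu
    have : Subsingleton (R ⧸ (⊤ : Ideal R)) := Ideal.Quotient.subsingleton_iff.mpr rfl
    rw [← Ideal.one_eq_top, normalizedFactors_one, Multiset.map_zero, Multiset.prod_zero,
      Ideal.one_eq_top, Algebra.norm_apply, LinearMap.det_eq_one_of_subsingleton]
  | h₃ I Q hI0 hQ ih =>
    have hQ0 := hQ.ne_zero
    have := Ideal.isPrime_of_prime hQ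
    have : Q.IsMaximal := Ring.DimensionLEOne.maximalOfPrime hQ0 this
    have := hfin (Q * I) hI
    rw [norm_quotient_prime_mul hQ0 hI0, ih hI0, normalizedFactors_mul hQ0 hI0,
      normalizedFactors_irreducible hQ.irreducible]
    simp

end Determinants

/-! ### Norms on quotients as products over finite places -/

section PlacesNorm

open IsLocalRing Polynomial UniqueFactorizationMonoid

theorem mem_maximalIdeal_pow_iff (O : Type*) [CommRing O] [IsDomain O] [IsDiscreteValuationRing O]
    {F : Type*} [Field F] [Algebra O F] [IsFractionRing O F] {a : O} (ha : a ≠ 0) (n : ℕ) :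
    a ∈ maximalIdeal O ^ n ↔ n ≤ ordv O (algebraMap O F a) := by
  obtain ⟨ϖ, hϖ⟩ := IsDiscreteValuationRing.exists_irreducible O
  have hπ : algebraMap O F ϖ ≠ 0 := by simpa using hϖ.ne_zero
  have ha' : algebraMap O F a ≠ 0 := by simpa using ha
  rw [hϖ.maximalIdeal_eq, Ideal.span_singleton_pow, Ideal.mem_span_singleton]
  have : 0 ≤ ordv O (algebraMap O F a / algebraMap O F ϖ ^ n) ↔ n ≤ ordv O (algebraMap O F a) := by
    rw [ordv_div O ha' (pow_ne_zero _ hπ), ordv_pow O hπ, ordv_irreducible O hϖ]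
    omega
  rw [← this, ordv_nonneg_iff O (div_ne_zero ha' (pow_ne_zero _ hπ))]
  refine exists_congr fun c ↦ ?_
  rw [eq_div_iff (pow_ne_zero _ hπ), ← map_pow, ← map_mul,
    (IsFractionRing.injective O F).eq_iff, mul_comm]
  exact eq_comm

variable {k F P : Type*} [Field k] [Field F] [Algebra k F] {O : P → Type*}
  [∀ p, CommRing (O p)] [∀ p, IsDomain (O p)] [∀ p, IsDiscreteValuationRing (O p)]
  [∀ p, Algebra (O p) F] [∀ p, IsFractionRing (O p) F] [∀ p, Algebra k (O p)]
  [∀ p, IsScalarTower k (O p) F]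
  [Algebra k[X] F] [IsScalarTower k k[X] F] [FaithfulSMul k[X] F]

/-- The algebra structure on the valuation ring of a finite place. -/
noncomputable abbrev placeAlgebra (p : FinitePlace k F O) :
    Algebra (integralClosure k[X] F) (O p.1) := (toPlace p).toAlgebra

theorem isLocalization_center (h : IsCompletePlaces k F O) (p : FinitePlace k F O) :
    letI := placeAlgebra p
    IsLocalization.AtPrime (O p.1) (center p) := by
  let := placeAlgebra p
  refine ⟨⟨fun y ↦ ?_, fun x ↦ ?_, fun {x y} hxy ↦ ⟨1, ?_⟩⟩⟩
  · by_contra hcon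
    exact y.2 hcon
  · obtain ⟨s, r, hs, hsr⟩ := exists_mul_mem_integralClosure h p x
    refine ⟨(r, ⟨s, hs⟩), IsFractionRing.injective (O p.1) F ?_⟩
    change _ = algebraMap (O p.1) F (toPlace p r)
    rw [map_mul, algebraMap_toPlace, ← hsr]
    congr 1
    exact algebraMap_toPlace p s
  · rw [toPlace_injective p hxy]

/-- Localization identifies the quotient by the n-th power of the center with the quotient of `O p`
by the n-th power of its maximal ideal, so both sides count the same powers containing `a`. -/
theorem natCast_count_center (h : IsCompletePlaces k F O) (p : FinitePlace k F O)
    [IsDedekindDomain (integralClosure k[X] F)] {a : integralClosure k[X] F} (ha : a ≠ 0) :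
    ((normalizedFactors (Ideal.span {a})).count (center p) : ℤ) = ordv (O p.1) (a : F) := by
  let := placeAlgebra p
  have := isLocalization_center h p
  have := center_isMaximal h p
  have ha' : toPlace p a ≠ 0 := by
    rwa [Ne, ← map_zero (toPlace p), (toPlace_injective p).eq_iff]
  have key (n : ℕ) : Ideal.span {a} ≤ center p ^ n ↔ n ≤ ordv (O p.1) (a : F) := by
    rw [← algebraMap_toPlace p a, ← mem_maximalIdeal_pow_iff (O p.1) ha',
      Ideal.span_singleton_le_iff_mem, ← Ideal.Quotient.eq_zero_iff_mem,
      ← Ideal.Quotient.eq_zero_iff_mem,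
      ← map_eq_zero_iff (IsLocalization.AtPrime.equivQuotMaximalIdealPow (center p) (O p.1) n)
        (AlgEquiv.injective _),
      IsLocalization.AtPrime.equivQuotMaximalIdealPow_apply_mk]
    rfl
  obtain ⟨n, hn⟩ := Int.eq_ofNat_of_zero_le (ordv_algebraMap_nonneg (F := F) (O p.1) (toPlace p a))
  rw [algebraMap_toPlace] at hn
  rw [hn]
  congr 1
  refine Ideal.count_normalizedFactors_eq ((key n).mpr hn.ge) fun hcon ↦ ?_
  have := (key _).mp hcon
  rw [hn] at this
  push_cast at this
  omega

theorem norm_quotient_center (h : IsCompletePlaces k F O) (p : FinitePlace k F O)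
    (b : integralClosure k[X] F) :
    Algebra.norm k (Ideal.Quotient.mk (center p) b) = Algebra.norm k (value (O p.1) (b : F)) := by
  let := placeAlgebra p
  have := isLocalization_center h p
  have := center_isMaximal h p
  let e : (integralClosure k[X] F ⧸ center p) ≃ₐ[k] ResidueField (O p.1) :=
    AlgEquiv.ofRingEquiv (f := IsLocalization.AtPrime.equivQuotMaximalIdeal (center p) (O p.1))
      fun c ↦ by
        change IsLocalization.AtPrime.equivQuotMaximalIdeal (center p) (O p.1)
          (Ideal.Quotient.mk _ (algebraMap k _ c)) = _
        rw [IsLocalization.AtPrime.equivQuotMaximalIdeal_apply_mk]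
        exact congr_arg (residue (O p.1)) (toPlace_algebraMap p c)
  rw [← Algebra.norm_eq_of_algEquiv e]
  congr 1
  rw [← algebraMap_toPlace p b, value_algebraMap]
  exact IsLocalization.AtPrime.equivQuotMaximalIdeal_apply_mk (center p) (O p.1) b

theorem finite_ordv_ne_zero_of_finitePlace (h : IsCompletePlaces k F O)
    {a : integralClosure k[X] F}
    (ha : a ≠ 0) : {p : FinitePlace k F O | ordv (O p.1) (a : F) ≠ 0}.Finite := by
  classical
  have := isDedekindDomain_integralClosure h
  refine Set.Finite.of_finite_image (f := center)
    ((normalizedFactors (Ideal.span {a})).toFinset.finite_toSet.subset ?_)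
    (center_injective h).injOn
  rintro _ ⟨p, hp, rfl⟩
  rw [Set.mem_ofPred_eq, ← natCast_count_center h p ha] at hp
  rw [Finset.mem_coe, Multiset.mem_toFinset, ← Multiset.count_pos]
  omega

theorem finite_quotient_integralClosure (h : IsCompletePlaces k F O)
    {I : Ideal (integralClosure k[X] F)} (hI : I ≠ ⊥) :
    Module.Finite k (integralClosure k[X] F ⧸ I) := by
  have := finite_integralClosure h
  have : Module.IsTorsionFree k[X] (integralClosure k[X] F) := inferInstance
  let b := Module.Free.chooseBasis k[X] (integralClosure k[X] F)
  exact Module.Finite.equiv (I.quotientEquivDirectSum k b hI).symm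

/-- The prime factors of the ideal generated by `a` are centers of finite places, with multiplicity
the order of `a`. It is applied with `a` or `b` equal to `X`. -/
theorem norm_quotient_span_eq_finprod (h : IsCompletePlaces k F O)
    {a : integralClosure k[X] F} (ha : a ≠ 0) (b : integralClosure k[X] F) :
    Algebra.norm k (Ideal.Quotient.mk (Ideal.span {a}) b) =
      ∏ᶠ p : FinitePlace k F O,
        Algebra.norm k (value (O p.1) (b : F)) ^ ordv (O p.1) (a : F) := by
  classical
  have := isDedekindDomain_integralClosure h
  have hne : Ideal.span {a} ≠ ⊥ := by simpa using ha
  rw [norm_quotient_eq_prod (fun _ hI ↦ finite_quotient_integralClosure h hI) hne,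
    Finset.prod_multiset_map_count]
  have hterm (p : FinitePlace k F O) :
      Algebra.norm k (value (O p.1) (b : F)) ^ ordv (O p.1) (a : F) =
        Algebra.norm k (Ideal.Quotient.mk (center p) b) ^
          (normalizedFactors (Ideal.span {a})).count (center p) := by
    rw [norm_quotient_center h, ← natCast_count_center h p ha, zpow_natCast]
  simp_rw [hterm]
  rw [finprod_eq_prod_of_mulSupport_subset
    (s := (finite_ordv_ne_zero_of_finitePlace h ha).toFinset)]
  · symm
    refine Finset.prod_bij (fun p _ ↦ center p) ?_ (fun p _ q _ hpq ↦ center_injective h hpq) ?_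
      (fun _ _ ↦ rfl)
    · intro p hp
      rw [Set.Finite.mem_toFinset, Set.mem_ofPred_eq, ← natCast_count_center h p ha] at hp
      rw [Multiset.mem_toFinset, ← Multiset.count_pos]
      omega
    · intro Q hQ
      rw [Multiset.mem_toFinset] at hQ
      have hQp := prime_of_normalized_factor Q hQ
      have := Ideal.isPrime_of_prime hQp
      have : Q.IsMaximal := Ring.DimensionLEOne.maximalOfPrime hQp.ne_zero this
      obtain ⟨p, rfl⟩ := exists_center_eq h Q
      refine ⟨p, ?_, rfl⟩
      rw [Set.Finite.mem_toFinset, Set.mem_ofPred_eq, ← natCast_count_center h p ha]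
      have := Multiset.count_pos.mpr hQ
      omega
  · intro p hp
    rw [Set.Finite.coe_toFinset, Set.mem_ofPred_eq, ← natCast_count_center h p ha]
    intro hcon
    rw [Int.natCast_eq_zero] at hcon
    simp [hcon] at hp

end PlacesNorm

/-! ### Norms on quotients in terms of the norm to k[X] -/

section NormPolynomial

open Polynomial

theorem det_pi_dependent {k ι : Type*} [Field k] [Fintype ι] {M : ι → Type*}
    [∀ i, AddCommGroup (M i)] [∀ i, Module k (M i)] [∀ i, Module.Finite k (M i)]
    (f : ∀ i, M i →ₗ[k] M i) :
    (LinearMap.pi fun i ↦ f i ∘ₗ LinearMap.proj i).det = ∏ i, (f i).det := by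
  let hord : LinearOrder ι := LinearOrder.lift' (Fintype.equivFin ι) (Fintype.equivFin ι).injective
  let b (i : ι) := Module.Free.chooseBasis k (M i)
  rw [← LinearMap.det_toMatrix (Pi.basis b)]
  have : LinearMap.toMatrix (Pi.basis b) (Pi.basis b)
      (LinearMap.pi fun i ↦ f i ∘ₗ LinearMap.proj i) =
      Matrix.blockDiagonal' fun i ↦ LinearMap.toMatrix (b i) (b i) (f i) := by
    ext ⟨i, x⟩ ⟨j, y⟩
    rw [LinearMap.toMatrix_apply, Pi.basis_repr, Pi.basis_apply, Matrix.blockDiagonal'_apply]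
    simp only [LinearMap.pi_apply, LinearMap.comp_apply, LinearMap.proj_apply]
    split_ifs with h
    · subst h
      simp [LinearMap.toMatrix_apply]
    · simp [Pi.single_eq_of_ne h]
  rw [this, (Matrix.blockTriangular_blockDiagonal' _).det_fintype]
  refine Finset.prod_congr rfl fun i _ ↦ ?_
  rw [← LinearMap.det_toMatrix (b i),
    ← Matrix.det_submatrix_equiv_self (Equiv.sigmaSubtype i).symm]
  congr 1
  ext x y
  simp [Matrix.toSquareBlock_def, Equiv.sigmaSubtype, Matrix.blockDiagonal'_apply]

variable {k : Type*} [Field k]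

/-- The constant coefficient of the monic polynomial associated to `h`, up to sign: the product of
the roots of `h`. -/
noncomputable def rootProd (h : k[X]) : k := (-1) ^ h.natDegree * h.coeff 0 / h.leadingCoeff

theorem rootProd_mul {f g : k[X]} (hf : f ≠ 0) (hg : g ≠ 0) :
    rootProd (f * g) = rootProd f * rootProd g := by
  rw [rootProd, rootProd, rootProd, natDegree_mul hf hg, leadingCoeff_mul, mul_coeff_zero, pow_add,
    div_mul_div_comm]
  congr 1
  ring

theorem rootProd_C {c : k} (hc : c ≠ 0) : rootProd (C c) = 1 := by
  simp [rootProd, hc]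

theorem rootProd_eq_of_associated {f g : k[X]} (hf : f ≠ 0) (h : Associated f g) :
    rootProd f = rootProd g := by
  obtain ⟨u, rfl⟩ := h
  obtain ⟨c, hc, hcu⟩ := Polynomial.isUnit_iff.mp u.isUnit
  rw [rootProd_mul hf u.ne_zero, ← hcu, rootProd_C hc.ne_zero, mul_one]

theorem rootProd_prod {ι : Type*} (s : Finset ι) {f : ι → k[X]} (hf : ∀ i ∈ s, f i ≠ 0) :
    rootProd (∏ i ∈ s, f i) = ∏ i ∈ s, rootProd (f i) := by
  classical
  induction s using Finset.induction_on with
  | empty => simpa using rootProd_C (one_ne_zero (α := k))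
  | insert i s hi ih =>
    rw [Finset.prod_insert hi, Finset.prod_insert hi, rootProd_mul (hf i (by simp))
      (Finset.prod_ne_zero_iff.mpr fun j hj ↦ hf j (by simp [hj])),
      ih fun j hj ↦ hf j (by simp [hj])]

theorem norm_mk_X {d : k[X]} (hd : d ≠ 0) :
    Algebra.norm k (Ideal.Quotient.mk (Ideal.span {d}) X) = rootProd d := by
  have := Algebra.PowerBasis.norm_gen_eq_coeff_zero_minpoly (AdjoinRoot.powerBasis hd)
  rw [AdjoinRoot.powerBasis_gen, AdjoinRoot.minpoly_root hd, AdjoinRoot.powerBasis_dim] at this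
  refine Eq.trans this ?_
  rw [rootProd, coeff_mul_C]
  ring

variable {S : Type*} [CommRing S] [Algebra k[X] S] [Algebra k S]
  [IsScalarTower k k[X] S] [Module.Finite k[X] S] [Module.IsTorsionFree k[X] S]

/-- Setting `X = 0` in the matrix of `a` on a k[X]-basis of `S` gives its matrix on S/XS. -/
theorem norm_quotient_span_X (a : S) :
    Algebra.norm k (Ideal.Quotient.mk (Ideal.span {algebraMap k[X] S X}) a) =
      (Algebra.norm k[X] a).coeff 0 := by
  classical
  let b := Module.Free.chooseBasis k[X] S
  let ev : k[X] →+* k := constantCoeff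
  let π : S →ₗ[k] (_ → k) :=
    { toFun := fun r i ↦ ev (b.repr r i)
      map_add' := fun r s ↦ by ext i; simp
      map_smul' := fun c r ↦ by
        ext i
        rw [← algebraMap_smul k[X] c r, map_smul]
        simp [ev] }
  have hπ (r : S) (i) : π r i = ev (b.repr r i) := rfl
  have hsurj : Function.Surjective π := by
    intro v
    refine ⟨∑ i, C (v i) • b i, ?_⟩
    ext i
    rw [hπ, map_sum]
    simp [ev, Finsupp.single_apply]
  have hker : π.ker = (Ideal.span {algebraMap k[X] S X}).restrictScalars k := by
    ext r
    rw [LinearMap.mem_ker, Submodule.restrictScalars_mem, Ideal.mem_span_singleton']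
    constructor
    · intro hr
      have hX (i) : ∃ q, b.repr r i = X * q := by
        have : ev (b.repr r i) = 0 := congr_fun hr i
        exact X_dvd_iff.mpr this
      choose q hq using hX
      refine ⟨∑ i, q i • b i, ?_⟩
      rw [← b.sum_repr r, Finset.sum_mul]
      refine Finset.sum_congr rfl fun i _ ↦ ?_
      rw [hq, mul_smul, Algebra.smul_def X, mul_comm]
    · rintro ⟨s, rfl⟩
      ext i
      rw [hπ, mul_comm, ← Algebra.smul_def, map_smul]
      simp [ev]
  let e : (S ⧸ Ideal.span {algebraMap k[X] S X}) ≃ₗ[k] (_ → k) :=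
    ((Submodule.Quotient.restrictScalarsEquiv k _).symm.trans
      (Submodule.quotEquivOfEq _ _ hker.symm)).trans (π.quotKerEquivOfSurjective hsurj)
  have he (r : S) : e (Ideal.Quotient.mk _ r) = π r := rfl
  let M := Algebra.leftMulMatrix b a
  have hnorm : (Algebra.norm k[X] a).coeff 0 = (Matrix.toLin' (M.map ev)).det := by
    rw [LinearMap.det_toLin', Algebra.norm_eq_matrix_det b]
    exact RingHom.map_det ev M
  rw [hnorm, Algebra.norm_apply, ← LinearMap.det_conj _ e]
  congr 1
  refine LinearMap.ext fun x ↦ ?_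
  obtain ⟨y, rfl⟩ := e.surjective x
  obtain ⟨r, rfl⟩ := Ideal.Quotient.mk_surjective y
  simp only [LinearMap.comp_apply, LinearEquiv.coe_coe, e.symm_apply_apply]
  change e (Ideal.Quotient.mk _ (a * r)) = _
  rw [he, he, Matrix.toLin'_apply]
  ext i
  rw [hπ, ← Algebra.leftMulMatrix_mulVec_repr b a r, RingHom.map_mulVec]
  rfl

variable [IsDomain S]

/-- In Smith normal form S/(a) is a product of quotients k[X]/(d_i), on each of which `X` has
determinant `rootProd` of d_i; the product of the d_i is associated to the norm of `a`. -/
theorem norm_quotient_X {a : S} (ha : a ≠ 0) :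
    Algebra.norm k (Ideal.Quotient.mk (Ideal.span {a}) (algebraMap k[X] S X)) =
      rootProd (Algebra.norm k[X] a) := by
  classical
  let b := Module.Free.chooseBasis k[X] S
  have hI : Ideal.span {a} ≠ ⊥ := by simpa using ha
  have hd := Ideal.smithCoeffs_ne_zero b _ hI
  have hn : Algebra.norm k[X] a ≠ 0 := by
    rw [Algebra.norm_ne_zero_iff_of_basis b]; exact ha
  rw [rootProd_eq_of_associated hn (associated_norm_prod_smith b ha),
    rootProd_prod _ fun i _ ↦ hd i]
  simp_rw [← norm_mk_X (hd _)]
  let e := Ideal.quotientEquivPiSpan (Ideal.span {a}) b hI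
  rw [Algebra.norm_apply, ← LinearMap.det_conj _ (e.restrictScalars k)]
  simp_rw [Algebra.norm_apply]
  rw [← det_pi_dependent]
  congr 1
  refine LinearMap.ext fun x ↦ ?_
  obtain ⟨y, rfl⟩ := e.surjective x
  have h1 : (e.restrictScalars k).symm (e y) = y := e.symm_apply_apply y
  simp only [LinearMap.comp_apply, LinearEquiv.coe_coe, h1]
  have h2 : Algebra.lmul k _ (Ideal.Quotient.mk (Ideal.span {a}) (algebraMap k[X] S X)) y =
      (X : k[X]) • y := by
    obtain ⟨y, rfl⟩ := Ideal.Quotient.mk_surjective y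
    rw [Algebra.smul_def]; rfl
  refine Eq.trans (congr_arg e h2) ?_
  rw [map_smul]
  ext i
  rw [Pi.smul_apply, Algebra.smul_def]
  rfl

end NormPolynomial

/-! ### Values of the norm of g over the affine line -/

section AffineNorm

open IsLocalRing Polynomial nonZeroDivisors

theorem algebraMap_X_ne_zero {k F : Type*} [Field k] [Field F] [Algebra k[X] F]
    [FaithfulSMul k[X] F] : algebraMap k[X] (integralClosure k[X] F) X ≠ 0 := by
  simp

variable {k F P : Type*} [Field k] [Field F] [Algebra k F] {O : P → Type*}
  [∀ p, CommRing (O p)] [∀ p, IsDomain (O p)] [∀ p, IsDiscreteValuationRing (O p)]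
  [∀ p, Algebra (O p) F] [∀ p, IsFractionRing (O p) F] [∀ p, Algebra k (O p)]
  [∀ p, IsScalarTower k (O p) F]

variable [Algebra k[X] F] [IsScalarTower k k[X] F]

theorem mem_center_iff_ordv_pos (p : FinitePlace k F O) {a : integralClosure k[X] F} (ha : a ≠ 0) :
    a ∈ center p ↔ 0 < ordv (O p.1) (a : F) := by
  have ha' : toPlace p a ≠ 0 := by
    rwa [Ne, ← map_zero (toPlace p), (toPlace_injective p).eq_iff]
  rw [mem_center_iff, ← residue_eq_zero_iff, residue_eq_zero_iff_ordv_pos (F := F) _ ha',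
    algebraMap_toPlace]

theorem ordv_nonneg_of_finitePlace (p : FinitePlace k F O) (a : integralClosure k[X] F) :
    0 ≤ ordv (O p.1) (a : F) := by
  rw [← algebraMap_toPlace p a]
  exact ordv_algebraMap_nonneg _ _

variable [FaithfulSMul k[X] F]

theorem algebraMap_norm_integralClosure (h : IsCompletePlaces k F O) {K : Type*} [Field K]
    [Algebra k[X] K] [IsFractionRing k[X] K] [Algebra K F] [IsScalarTower k[X] K F]
    (a : integralClosure k[X] F) :
    Algebra.norm K (a : F) = algebraMap k[X] K (Algebra.norm k[X] a) := by
  have := finite_integralClosure h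
  have : Algebra.IsAlgebraic K F :=
    ⟨fun x ↦ (IsFractionRing.isAlgebraic_iff k[X] K F).mp (isAlgebraic_of_isCompletePlaces h x)⟩
  have := IsIntegralClosure.isLocalization k[X] K F (integralClosure k[X] F)
  exact Algebra.norm_localization k[X] k[X]⁰ (Sₘ := F) a

/-- The denominators of `g` form an ideal. It is comaximal with `X`, since `g` is integral at the
zeros of `X`; so the denominator can be taken congruent to 1 modulo `X`. -/
theorem exists_eq_div_of_ordv_eq_zero (h : IsCompletePlaces k F O) {g : F} (hg : g ≠ 0)
    (hunit : ∀ p : P, 0 < ordv (O p) (algebraMap k[X] F X) → ordv (O p) g = 0) :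
    ∃ a b r : integralClosure k[X] F, b ≠ 0 ∧ g * b = a ∧
      b + r * algebraMap k[X] _ X = 1 := by
  let I : Ideal (integralClosure k[X] F) :=
    { carrier := {s | ∃ r : integralClosure k[X] F, g * s = r}
      add_mem' := by
        rintro s s' ⟨r, hr⟩ ⟨r', hr'⟩
        exact ⟨r + r', by push_cast; rw [mul_add, hr, hr']⟩
      zero_mem' := ⟨0, by simp⟩
      smul_mem' := by
        rintro c s ⟨r, hr⟩
        exact ⟨c * r, by rw [smul_eq_mul]; push_cast; rw [← hr]; ring⟩ }
  have htop : I ⊔ Ideal.span {algebraMap k[X] _ X} = ⊤ := by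
    by_contra hne
    obtain ⟨M, hM, hle⟩ := Ideal.exists_le_maximal _ hne
    obtain ⟨p, rfl⟩ := exists_center_eq h M
    have hX := hle (Ideal.mem_sup_right (Ideal.mem_span_singleton_self _))
    rw [mem_center_iff_ordv_pos p algebraMap_X_ne_zero] at hX
    have hgO := (ordv_nonneg_iff (O p.1) hg).mp (hunit p.1 hX).ge
    obtain ⟨x, rfl⟩ := hgO
    obtain ⟨s, r, hs, hsr⟩ := exists_mul_mem_integralClosure h p x
    exact hs (hle (Ideal.mem_sup_left ⟨r, hsr⟩))
  rw [Ideal.eq_top_iff_one, Submodule.mem_sup] at htop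
  obtain ⟨b, ⟨a, ha⟩, y, hy, hby⟩ := htop
  obtain ⟨r, rfl⟩ := Ideal.mem_span_singleton'.mp hy
  refine ⟨a, b, r, ?_, ha, hby⟩
  -- If `b = 0`, then `X` is a unit in the integral closure, hence already in k[X] by integrality.
  rintro rfl
  rw [zero_add, mul_comm] at hby
  have hu : IsUnit (algebraMap k[X] (integralClosure k[X] F) X) := .of_mul_eq_one _ hby
  have hloc : IsLocalHom (algebraMap k[X] (integralClosure k[X] F)) :=
    inferInstance
  exact not_isUnit_X (hloc.map_nonunit _ hu)

/-- Here `h₁` and `h₂` are the norms of a numerator and a denominator of `g`, both units at the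
zeros of `X`. The two products are the value at 0 of the norm of `g` and the quotient of the
products of roots. -/
theorem exists_norm_eq_div (h : IsCompletePlaces k F O) {K : Type*} [Field K]
    [Algebra k[X] K] [IsFractionRing k[X] K] [Algebra K F] [IsScalarTower k[X] K F]
    {g : F} (hg : g ≠ 0)
    (hunit : ∀ p : P, 0 < ordv (O p) (algebraMap k[X] F X) → ordv (O p) g = 0) :
    ∃ h₁ h₂ : k[X], h₁.coeff 0 ≠ 0 ∧ h₂.coeff 0 ≠ 0 ∧
      Algebra.norm K g = algebraMap k[X] K h₁ / algebraMap k[X] K h₂ ∧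
      (∏ᶠ p : FinitePlace k F O, Algebra.norm k (value (O p.1) g) ^
        ordv (O p.1) (algebraMap k[X] F X)) = h₁.coeff 0 / h₂.coeff 0 ∧
      (∏ᶠ p : FinitePlace k F O, Algebra.norm k (value (O p.1) (algebraMap k[X] F X)) ^
        ordv (O p.1) g) = rootProd h₁ / rootProd h₂ := by
  obtain ⟨a, b, r, hb0, hab, hbr⟩ := exists_eq_div_of_ordv_eq_zero h hg hunit
  have := finite_integralClosure h
  set t : integralClosure k[X] F := algebraMap k[X] _ X with ht
  have htF : algebraMap k[X] F X = (t : F) := rfl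
  rw [htF] at hunit
  change ∃ h₁ h₂ : k[X], _ ∧ _ ∧ _ ∧
    (∏ᶠ p : FinitePlace k F O, Algebra.norm k (value (O p.1) g) ^ ordv (O p.1) (t : F)) = _ ∧
    (∏ᶠ p : FinitePlace k F O, Algebra.norm k (value (O p.1) (t : F)) ^ ordv (O p.1) g) = _
  have ht0 : t ≠ 0 := algebraMap_X_ne_zero
  have hbF : (b : F) ≠ 0 := fun hcon ↦ hb0 (Subtype.ext hcon)
  have haF : (a : F) ≠ 0 := hab ▸ mul_ne_zero hg hbF
  have ha0 : a ≠ 0 := by rintro rfl; exact haF rfl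
  have hg' : g = a / b := by rw [← hab, mul_div_cancel_right₀ _ hbF]
  have hord (p : FinitePlace k F O) :
      ordv (O p.1) g = ordv (O p.1) (a : F) - ordv (O p.1) (b : F) := by
    rw [hg', ordv_div _ haF hbF]
  have hob (p : FinitePlace k F O) (hp : 0 < ordv (O p.1) (t : F)) : ordv (O p.1) (b : F) = 0 := by
    by_contra hne
    have hbp : b ∈ center p := (mem_center_iff_ordv_pos p hb0).mpr
      (lt_of_le_of_ne (ordv_nonneg_of_finitePlace p b) (Ne.symm hne))
    have htp : t ∈ center p := (mem_center_iff_ordv_pos p ht0).mpr hp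
    refine (inferInstance : (center p).IsPrime).ne_top ((Ideal.eq_top_iff_one _).mpr ?_)
    rw [← hbr]
    exact add_mem hbp (Ideal.mul_mem_left _ _ htp)
  have hoa (p : FinitePlace k F O) (hp : 0 < ordv (O p.1) (t : F)) : ordv (O p.1) (a : F) = 0 := by
    have := hord p
    rw [hunit p.1 hp, hob p hp] at this
    omega
  have hsupp (c d : integralClosure k[X] F) (hc : c ≠ 0) :
      (Function.mulSupport fun p : FinitePlace k F O ↦
        Algebra.norm k (value (O p.1) (d : F)) ^ ordv (O p.1) (c : F)).Finite := by
    refine (finite_ordv_ne_zero_of_finitePlace h hc).subset fun p hp hcon ↦ hp ?_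
    beta_reduce
    rw [hcon, zpow_zero]
  have hcoeff (c : integralClosure k[X] F) : (Algebra.norm k[X] c).coeff 0 =
      ∏ᶠ p : FinitePlace k F O, Algebra.norm k (value (O p.1) (c : F)) ^ ordv (O p.1) (t : F) := by
    rw [← norm_quotient_span_eq_finprod h ht0, ht, norm_quotient_span_X]
  have hnorm0 (p : FinitePlace k F O) {x : F} (hx : x ≠ 0) (hxp : ordv (O p.1) x = 0) :
      Algebra.norm k (value (O p.1) x) ≠ 0 := by
    have := h.finite_residueField p.1
    exact Algebra.norm_ne_zero_iff.mpr (value_ne_zero _ hx hxp)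
  have hcoeff0 (c : integralClosure k[X] F) (hc0 : (c : F) ≠ 0)
      (hc : ∀ p : FinitePlace k F O, 0 < ordv (O p.1) (t : F) → ordv (O p.1) (c : F) = 0) :
      (Algebra.norm k[X] c).coeff 0 ≠ 0 := by
    rw [hcoeff]
    refine finprod_induction (· ≠ 0) one_ne_zero (fun _ _ ↦ mul_ne_zero) fun p ↦ ?_
    rcases (ordv_nonneg_of_finitePlace p t).eq_or_lt with h0 | hpos
    · rw [← h0, zpow_zero]; exact one_ne_zero
    · exact zpow_ne_zero _ (hnorm0 p hc0 (hc p hpos))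
  refine ⟨Algebra.norm k[X] a, Algebra.norm k[X] b, hcoeff0 a haF hoa, hcoeff0 b hbF hob, ?_, ?_, ?_⟩
  · have hne : algebraMap k[X] K (Algebra.norm k[X] b) ≠ 0 := by
      have : Algebra.norm k[X] b ≠ 0 := by
        intro hcon
        exact hcoeff0 b hbF hob (by rw [hcon, coeff_zero])
      simpa using this
    rw [eq_div_iff hne, ← algebraMap_norm_integralClosure h, ← algebraMap_norm_integralClosure h,
      ← map_mul, hab]
  · rw [hcoeff, hcoeff, ← finprod_div_distrib (hsupp t a ht0) (hsupp t b ht0)]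
    refine finprod_congr fun p ↦ ?_
    rcases (ordv_nonneg_of_finitePlace p t).eq_or_lt with h0 | hpos
    · simp [← h0]
    · rw [← div_zpow, ← hab, value_mul _ hg hbF (hunit p.1 hpos).ge (hob p hpos).ge, map_mul,
        mul_div_cancel_right₀ _ (hnorm0 p hbF (hob p hpos))]
  · rw [← norm_quotient_X ha0, ← norm_quotient_X hb0, norm_quotient_span_eq_finprod h ha0,
      norm_quotient_span_eq_finprod h hb0,
      ← finprod_div_distrib (hsupp a t ha0) (hsupp b t hb0)]
    refine finprod_congr fun p ↦ ?_
    rcases (ordv_nonneg_of_finitePlace p t).eq_or_lt with h0 | hpos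
    · rw [hord, zpow_sub₀ (hnorm0 p (fun hcon ↦ ht0 (Subtype.ext hcon)) h0.symm)]
    -- At a zero of `X` the value of `X` is 0, but all exponents vanish.
    · rw [hunit p.1 hpos, hoa p hpos, hob p hpos]
      simp

end AffineNorm

/-! ### Comparing a rational function at 0 and at infinity -/

section Polynomials

open Polynomial

theorem aeval_eq_aeval_inv_reverse_mul {k F : Type*} [Field k] [Field F] [Algebra k F]
    {u : F} (hu : u ≠ 0) (f : k[X]) :
    aeval u f = aeval u⁻¹ f.reverse * u ^ f.natDegree := by
  let := invertibleOfNonzero hu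
  rw [aeval_def, aeval_def, ← eval₂_reverse_mul_pow (algebraMap k F) u f, invOf_eq_inv]

/-- Two expressions of an element of `k(t)`, in terms of `t` and of `t⁻¹`. -/
theorem natDegree_eq_and_leadingCoeff_mul_eq {k F : Type*} [Field k] [Field F] [Algebra k F] {t : F}
    (ht : Transcendental k t) {a b a' b' : k[X]} (ha : a.coeff 0 ≠ 0) (hb : b.coeff 0 ≠ 0)
    (ha' : a'.coeff 0 ≠ 0) (hb' : b'.coeff 0 ≠ 0)
    (h : aeval t a / aeval t b = aeval t⁻¹ a' / aeval t⁻¹ b') :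
    a.natDegree = b.natDegree ∧
      a.leadingCoeff * b'.coeff 0 = b.leadingCoeff * a'.coeff 0 := by
  have hne {q : k[X]} (hq : q.coeff 0 ≠ 0) : q ≠ 0 := by rintro rfl; simp at hq
  have hrne {q : k[X]} (hq : q.coeff 0 ≠ 0) : q.reverse ≠ 0 := by
    rw [Ne, reverse_eq_zero]; exact hne hq
  have htr {q : k[X]} (hq : q.coeff 0 ≠ 0) : q.natTrailingDegree = 0 :=
    natTrailingDegree_eq_zero.mpr (.inr hq)
  have htr' (q : k[X]) : q.reverse.natTrailingDegree = 0 := natTrailingDegree_reverse q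
  have hdeg {q : k[X]} (hq : q.coeff 0 ≠ 0) : q.reverse.natDegree = q.natDegree := by
    rw [reverse_natDegree, htr hq, Nat.sub_zero]
  have hlc {q : k[X]} (hq : q.coeff 0 ≠ 0) : q.reverse.leadingCoeff = q.coeff 0 := by
    rw [reverse_leadingCoeff, trailingCoeff, htr hq]
  have ht0 : t ≠ 0 := by rintro rfl; exact ht isAlgebraic_zero
  have hinj := transcendental_iff_injective.mp ht
  have hev {q : k[X]} (hq : q ≠ 0) : aeval t q ≠ 0 := fun hcon ↦
    hq (hinj (by rw [hcon, map_zero]))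
  -- Reversing `a'` and `b'` clears the negative powers of `t`.
  have key : a * b'.reverse * X ^ a'.natDegree = b * a'.reverse * X ^ b'.natDegree := by
    apply hinj
    rw [aeval_eq_aeval_inv_reverse_mul (inv_ne_zero ht0) a',
      aeval_eq_aeval_inv_reverse_mul (inv_ne_zero ht0) b', inv_inv] at h
    have h1 := hev (hne hb)
    have h2 := hev (hrne hb')
    have h3 (n : ℕ) : t ^ n * t⁻¹ ^ n = 1 := by rw [← mul_pow, mul_inv_cancel₀ ht0, one_pow]
    simp only [map_mul, map_pow, aeval_X]
    rw [div_eq_div_iff h1 (mul_ne_zero h2 (pow_ne_zero _ (inv_ne_zero ht0)))] at h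
    linear_combination t ^ a'.natDegree * t ^ b'.natDegree * h -
      aeval t a * aeval t b'.reverse * t ^ a'.natDegree * h3 b'.natDegree +
      aeval t b * aeval t a'.reverse * t ^ b'.natDegree * h3 a'.natDegree
  -- All factors other than the powers of `X` have nonzero constant term, so those powers agree.
  have hda : a'.natDegree = b'.natDegree := by
    have := congr_arg natTrailingDegree key
    rwa [natTrailingDegree_mul_X_pow (mul_ne_zero (hne ha) (hrne hb')),
      natTrailingDegree_mul_X_pow (mul_ne_zero (hne hb) (hrne ha')),
      natTrailingDegree_mul (hne ha) (hrne hb'), natTrailingDegree_mul (hne hb) (hrne ha'),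
      htr ha, htr hb, htr', htr', add_zero, zero_add, zero_add] at this
  rw [hda] at key
  replace key := mul_right_cancel₀ (pow_ne_zero _ X_ne_zero) key
  constructor
  · have := congr_arg natDegree key
    rw [natDegree_mul (hne ha) (hrne hb'), natDegree_mul (hne hb) (hrne ha'), hdeg ha', hdeg hb',
      hda] at this
    omega
  · have := congr_arg leadingCoeff key
    rwa [leadingCoeff_mul, leadingCoeff_mul, hlc ha', hlc hb'] at this

end Polynomials

/-! ### Reciprocity for a complete family of places -/

section NormTame

open IsLocalRing Polynomial IntermediateField

variable {k F P : Type*} [Field k] [Field F] {O : P → Type*}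
  [∀ p, CommRing (O p)] [∀ p, IsDomain (O p)] [∀ p, IsDiscreteValuationRing (O p)]
  [∀ p, Algebra (O p) F] [∀ p, IsFractionRing (O p) F]

theorem tame_eq_one_of_ordv_eq_zero (p : P) {f g : F} (hf : f ≠ 0) (hfp : ordv (O p) f = 0)
    (hgp : ordv (O p) g = 0) : tame (O p) f g = 1 := by
  rw [tame_of_ordv_left_eq_zero hf hfp, hgp, zpow_zero]

theorem norm_zpow {k L : Type*} [Field k] [Field L] [Algebra k L] [Module.Finite k L] (x : L)
    (n : ℤ) : Algebra.norm k (x ^ n) = Algebra.norm k x ^ n := by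
  refine map_zpow' (Algebra.norm k) (fun x ↦ ?_) x n
  rcases eq_or_ne x 0 with rfl | hx
  · simp
  · exact eq_inv_of_mul_eq_one_left (by rw [← map_mul, inv_mul_cancel₀ hx, map_one])

/-- The three factors come from the values of `t` off its poles, the values of `g` at zeros of `t`,
and the values of `g` at poles of `t`. The conditions overlap where `t` has order zero, but there
the last two factors have exponent zero. -/
theorem norm_tame_eq_mul (p : P) [Algebra k (O p)] [Module.Finite k (ResidueField (O p))]
    {t g : F} (ht : t ≠ 0) (hg : g ≠ 0)
    (hp : ordv (O p) t = 0 ∨ ordv (O p) g = 0) :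
    Algebra.norm k (tame (O p) t g) =
      (if 0 ≤ ordv (O p) t then Algebra.norm k (value (O p) t) ^ ordv (O p) g else 1) /
      (if 0 ≤ ordv (O p) t then Algebra.norm k (value (O p) g) ^ ordv (O p) t else 1) *
      (if 0 ≤ ordv (O p) t⁻¹ then Algebra.norm k (value (O p) g) ^ ordv (O p) t⁻¹ else 1) := by
  rw [ordv_inv _ ht]
  by_cases ht0 : ordv (O p) t = 0
  · rw [tame_of_ordv_left_eq_zero ht ht0, norm_zpow, ht0]
    simp
  · have hg0 := hp.resolve_left ht0
    rw [tame_of_ordv_right_eq_zero hg hg0, norm_zpow, hg0]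
    rcases lt_or_gt_of_ne ht0 with hlt | hlt
    · rw [if_neg hlt.not_ge, if_neg hlt.not_ge, if_pos (by omega)]
      simp
    · rw [if_pos hlt.le, if_pos hlt.le, if_neg (by omega)]
      simp

variable [Algebra k F]

theorem isFractionRing_adjoin_simple {t : F} (ht : Transcendental k t) [Algebra k[X] k⟮t⟯]
    (h : ∀ q : k[X], (algebraMap k[X] k⟮t⟯ q : F) = aeval t q) : IsFractionRing k[X] k⟮t⟯ := by
  have hinj : Function.Injective (algebraMap k[X] k⟮t⟯) := fun q r hqr ↦
    transcendental_iff_injective.mp ht (by rw [← h, ← h, hqr])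
  have : FaithfulSMul k[X] k⟮t⟯ := (faithfulSMul_iff_algebraMap_injective _ _).mpr hinj
  refine .of_field k[X] k⟮t⟯ fun z ↦ ?_
  obtain ⟨r, s, hrs⟩ := (mem_adjoin_simple_iff k z.1).mp z.2
  exact ⟨r, s, Subtype.ext (by rw [hrs, IntermediateField.coe_div, h, h])⟩

variable [∀ p, Algebra k (O p)]

/-- The norm of the tame symbol. -/
noncomputable def normTame (h : IsCompletePlaces k F O) (p : P) (f g : Fˣ) : kˣ :=
  Units.mk0 (Algebra.norm k (tame (O p) (f : F) g)) <|
    have := h.finite_residueField p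
    Algebra.norm_ne_zero_iff.mpr (tame_ne_zero f.ne_zero g.ne_zero)

theorem coe_normTame (h : IsCompletePlaces k F O) (p : P) (f g : Fˣ) :
    (normTame h p f g : k) = Algebra.norm k (tame (O p) (f : F) g) := rfl

theorem normTame_mul_left (h : IsCompletePlaces k F O) (p : P) (f₁ f₂ g : Fˣ) :
    normTame h p (f₁ * f₂) g = normTame h p f₁ g * normTame h p f₂ g :=
  Units.ext <| by
    simp [coe_normTame, tame_mul_left f₁.ne_zero f₂.ne_zero g.ne_zero]

theorem normTame_mul_swap (h : IsCompletePlaces k F O) (p : P) (f g : Fˣ) :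
    normTame h p f g * normTame h p g f = 1 :=
  Units.ext <| by
    simp [coe_normTame, ← map_mul, tame_mul_tame_swap f.ne_zero g.ne_zero]

theorem normTame_mul_right (h : IsCompletePlaces k F O) (p : P) (f g₁ g₂ : Fˣ) :
    normTame h p f (g₁ * g₂) = normTame h p f g₁ * normTame h p f g₂ :=
  Units.ext <| by
    simp [coe_normTame, tame_mul_right f.ne_zero g₁.ne_zero g₂.ne_zero]

variable [∀ p, IsScalarTower k (O p) F]

/-- Such an element and its inverse are both integral over `k`, hence belong to every `O p`. -/
theorem ordv_eq_zero_of_isAlgebraic {f : F} (hf : f ≠ 0) (h : IsAlgebraic k f) (p : P) :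
    ordv (O p) f = 0 := by
  have key {x : F} (hx : x ≠ 0) (hi : IsAlgebraic k x) : 0 ≤ ordv (O p) x :=
    (ordv_nonneg_iff _ hx).mpr (IsIntegrallyClosed.isIntegral_iff.mp
      (hi.isIntegral.tower_top (A := O p)))
  have h1 := key hf h
  have h2 := key (inv_ne_zero hf) h.inv
  rw [ordv_inv _ hf] at h2
  omega

/-- `K` is a variable equal to `k⟮t⟯`, so that `t` and `t⁻¹` can be used with the norm to the same
field. -/
theorem exists_norm_eq (h : IsCompletePlaces k F O) {t g : F} (ht : Transcendental k t) (hg : g ≠ 0)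
    (hunit : ∀ p : P, 0 < ordv (O p) t → ordv (O p) g = 0) {K : IntermediateField k F}
    (hK : K = k⟮t⟯) :
    ∃ h₁ h₂ : k[X], h₁.coeff 0 ≠ 0 ∧ h₂.coeff 0 ≠ 0 ∧
      (Algebra.norm K g : F) = aeval t h₁ / aeval t h₂ ∧
      (∏ᶠ p, if 0 ≤ ordv (O p) t then Algebra.norm k (value (O p) g) ^ ordv (O p) t else 1) =
        h₁.coeff 0 / h₂.coeff 0 ∧
      (∏ᶠ p, if 0 ≤ ordv (O p) t then Algebra.norm k (value (O p) t) ^ ordv (O p) g else 1) =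
        rootProd h₁ / rootProd h₂ := by
  classical
  subst hK
  have ht0 : t ≠ 0 := by rintro rfl; exact ht isAlgebraic_zero
  let : Algebra k[X] F := (aeval t : k[X] →ₐ[k] F).toAlgebra
  have hX : algebraMap k[X] F X = t := aeval_X t
  have : IsScalarTower k k[X] F := .of_algebraMap_eq fun c ↦ (aeval_C t c).symm
  have : FaithfulSMul k[X] F :=
    (faithfulSMul_iff_algebraMap_injective _ _).mpr (transcendental_iff_injective.mp ht)
  let : Algebra k[X] k⟮t⟯ := (aeval (AdjoinSimple.gen k t) : k[X] →ₐ[k] k⟮t⟯).toAlgebra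
  have hq (q : k[X]) : (algebraMap k[X] k⟮t⟯ q : F) = aeval t q :=
    (aeval_algebraMap_apply F (AdjoinSimple.gen k t) q).symm
  have : IsScalarTower k[X] k⟮t⟯ F := .of_algebraMap_eq fun q ↦ (hq q).symm
  have := isFractionRing_adjoin_simple ht hq
  obtain ⟨h₁, h₂, h0, h0', hN, e1, e2⟩ := exists_norm_eq_div (K := k⟮t⟯) h hg (by rwa [hX])
  refine ⟨h₁, h₂, h0, h0', ?_, ?_, ?_⟩
  · rw [hN, IntermediateField.coe_div, hq, hq]
  · rw [← e1, finprod_subtype_eq_finprod_cond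
      (f := fun p ↦ Algebra.norm k (value (O p) g) ^ ordv (O p) (algebraMap k[X] F X))]
    refine finprod_congr fun p ↦ ?_
    rw [finprod_eq_if, hX, if_congr (ordv_nonneg_iff (O p) ht0) rfl rfl]
  · rw [← e2, finprod_subtype_eq_finprod_cond
      (f := fun p ↦ Algebra.norm k (value (O p) (algebraMap k[X] F X)) ^ ordv (O p) g)]
    refine finprod_congr fun p ↦ ?_
    rw [finprod_eq_if, hX, if_congr (ordv_nonneg_iff (O p) ht0) rfl rfl]

/-- The zeros of `t` are finite places whose centers divide the principal ideal of `t` in the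
integral closure of k[t]. -/
theorem finite_ordv_pos (h : IsCompletePlaces k F O) {t : F} (ht : Transcendental k t) :
    {p | 0 < ordv (O p) t}.Finite := by
  have ht0 : t ≠ 0 := by rintro rfl; exact ht isAlgebraic_zero
  let : Algebra k[X] F := (aeval t : k[X] →ₐ[k] F).toAlgebra
  have hX : algebraMap k[X] F X = t := aeval_X t
  have : IsScalarTower k k[X] F := .of_algebraMap_eq fun c ↦ (aeval_C t c).symm
  have : FaithfulSMul k[X] F :=
    (faithfulSMul_iff_algebraMap_injective _ _).mpr (transcendental_iff_injective.mp ht)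
  refine ((finite_ordv_ne_zero_of_finitePlace h (algebraMap_X_ne_zero (k := k) (F := F))).image
    Subtype.val).subset fun p (hp : 0 < ordv (O p) t) ↦ ?_
  refine ⟨⟨p, hX ▸ (ordv_nonneg_iff (O p) ht0).mp hp.le⟩, ?_, rfl⟩
  change ordv (O p) (algebraMap k[X] F X) ≠ 0
  rw [hX]
  exact hp.ne'

theorem finite_ordv_ne_zero (h : IsCompletePlaces k F O) {f : F} (hf : f ≠ 0) :
    {p | ordv (O p) f ≠ 0}.Finite := by
  by_cases hft : Transcendental k f
  · refine ((finite_ordv_pos h hft).union (finite_ordv_pos h (t := f⁻¹) fun hcon ↦ hft ?_)).subset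
      fun p hp ↦ ?_
    · simpa using hcon.inv
    · simp only [Set.mem_union, Set.mem_ofPred_eq, ordv_inv _ hf] at hp ⊢
      omega
  · have := ordv_eq_zero_of_isAlgebraic (O := O) hf (not_not.mp hft)
    simp [this]

theorem finite_tame_ne_one (h : IsCompletePlaces k F O) {f g : F} (hf : f ≠ 0) (hg : g ≠ 0) :
    {p | tame (O p) f g ≠ 1}.Finite := by
  refine ((finite_ordv_ne_zero h hf).union (finite_ordv_ne_zero h hg)).subset fun p hp ↦ ?_
  by_contra hcon
  simp only [Set.mem_union, Set.mem_ofPred_eq, not_or, not_not] at hcon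
  exact hp (tame_eq_one_of_ordv_eq_zero p hf hcon.1 hcon.2)

/-- Write the norm of `g` as a(t)/b(t) and as a'(t⁻¹)/b'(t⁻¹), all constant terms being nonzero. The
product is (rootProd a / rootProd b) · (b(0)/a(0)) · (a'(0)/b'(0)). Since `a` and `b` have the same
degree, the first two factors give the inverse ratio of leading coefficients, which cancels the
third, the value at infinity. -/
theorem finprod_norm_tame_of_disjoint (h : IsCompletePlaces k F O) {t g : F}
    (ht : Transcendental k t) (hg : g ≠ 0) (hdis : ∀ p, ordv (O p) t = 0 ∨ ordv (O p) g = 0) :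
    ∏ᶠ p, Algebra.norm k (tame (O p) t g) = 1 := by
  have ht0 : t ≠ 0 := by rintro rfl; exact ht isAlgebraic_zero
  have hadj : k⟮t⟯ = k⟮t⁻¹⟯ := by
    apply le_antisymm
    · rw [adjoin_simple_le_iff]
      simpa using inv_mem (mem_adjoin_simple_self k t⁻¹)
    · rw [adjoin_simple_le_iff]
      exact inv_mem (mem_adjoin_simple_self k t)
  have htu : Transcendental k t⁻¹ := fun hcon ↦ ht (by simpa using hcon.inv)
  obtain ⟨a, b, ha, hb, hN, e1, e2⟩ := exists_norm_eq h ht hg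
    (fun p hp ↦ (hdis p).resolve_left hp.ne') rfl
  obtain ⟨a', b', ha', hb', hN', e1', -⟩ := exists_norm_eq h htu hg
    (fun p hp ↦ (hdis p).resolve_left fun hcon ↦ by rw [ordv_inv _ ht0, hcon] at hp; simp at hp) hadj
  obtain ⟨hdeg, hlc⟩ := natDegree_eq_and_leadingCoeff_mul_eq ht ha hb ha' hb' (hN.symm.trans hN')
  have hft := finite_ordv_ne_zero h ht0
  have hfg := finite_ordv_ne_zero h hg
  rw [finprod_congr fun p ↦ have := h.finite_residueField p; norm_tame_eq_mul p ht0 hg (hdis p), finprod_mul_distrib,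
    finprod_div_distrib, e1, e2, e1', rootProd, rootProd, hdeg]
  · have hne {q : k[X]} (hq : q.coeff 0 ≠ 0) : q.leadingCoeff ≠ 0 :=
      leadingCoeff_ne_zero.mpr (by rintro rfl; simp at hq)
    have h1 := hne ha
    have h2 := hne hb
    field_simp
    linear_combination -hlc
  · refine hfg.subset fun p hp hcon ↦ hp ?_
    simp [hcon]
  · refine hft.subset fun p hp hcon ↦ hp ?_
    simp [hcon]
  · refine (hft.union hfg).subset fun p hp ↦ ?_
    by_contra hcon
    simp only [Set.mem_union, Set.mem_ofPred_eq, not_or, not_not] at hcon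
    exact hp (by simp [hcon])
  · refine hft.subset fun p hp hcon ↦ hp ?_
    simp [hcon, ordv_inv _ ht0]

theorem finite_normTame_ne_one (h : IsCompletePlaces k F O) (f g : Fˣ) :
    (Function.mulSupport fun p ↦ normTame h p f g).Finite :=
  (finite_tame_ne_one h f.ne_zero g.ne_zero).subset fun p hp hcon ↦
    hp (Units.ext (by rw [coe_normTame, hcon, map_one, Units.val_one]))

/-- The product of the norms of all tame symbols. -/
noncomputable def prodNormTame (h : IsCompletePlaces k F O) : Fˣ →* Fˣ →* kˣ :=
  .mk' (fun f ↦ .mk' (fun g ↦ ∏ᶠ p, normTame h p f g) fun g₁ g₂ ↦ by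
      simp_rw [normTame_mul_right]
      exact finprod_mul_distrib (finite_normTame_ne_one h _ _) (finite_normTame_ne_one h _ _))
    fun f₁ f₂ ↦ by
      ext1 g
      simp only [MonoidHom.mk'_apply, MonoidHom.mul_apply, normTame_mul_left]
      exact finprod_mul_distrib (finite_normTame_ne_one h _ _) (finite_normTame_ne_one h _ _)

theorem prodNormTame_apply (h : IsCompletePlaces k F O) (f g : Fˣ) :
    prodNormTame h f g = ∏ᶠ p, normTame h p f g := rfl

theorem coe_prodNormTame (h : IsCompletePlaces k F O) (f g : Fˣ) :
    (prodNormTame h f g : k) = ∏ᶠ p, Algebra.norm k (tame (O p) (f : F) g) := by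
  rw [prodNormTame_apply, ← Units.coeHom_apply,
    MonoidHom.map_finprod _ (finite_normTame_ne_one h f g)]
  rfl

theorem prodNormTame_mul_swap (h : IsCompletePlaces k F O) (f g : Fˣ) :
    prodNormTame h f g * prodNormTame h g f = 1 := by
  rw [prodNormTame_apply, prodNormTame_apply,
    ← finprod_mul_distrib (finite_normTame_ne_one h _ _) (finite_normTame_ne_one h _ _)]
  simp_rw [normTame_mul_swap, finprod_one]

theorem prodNormTame_of_disjoint (h : IsCompletePlaces k F O) {f g : Fˣ}
    (hfg : ∀ p, ordv (O p) (f : F) = 0 ∨ ordv (O p) (g : F) = 0) : prodNormTame h f g = 1 := by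
  by_cases hf : Transcendental k (f : F)
  · exact Units.ext ((coe_prodNormTame h f g).trans
      (finprod_norm_tame_of_disjoint h hf g.ne_zero hfg))
  by_cases hg : Transcendental k (g : F)
  · have : prodNormTame h g f = 1 := Units.ext ((coe_prodNormTame h g f).trans
      (finprod_norm_tame_of_disjoint h hg f.ne_zero fun p ↦ (hfg p).symm))
    rw [← prodNormTame_mul_swap h f g, this, mul_one]
  -- With `f` and `g` both algebraic over `k`, neither has a zero or a pole.
  refine finprod_eq_one_of_forall_eq_one fun p ↦ Units.ext ?_
  rw [coe_normTame, tame_eq_one_of_ordv_eq_zero p f.ne_zero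
    (ordv_eq_zero_of_isAlgebraic f.ne_zero (not_not.mp hf) p)
    (ordv_eq_zero_of_isAlgebraic g.ne_zero (not_not.mp hg) p), map_one, Units.val_one]

/-- Weil reciprocity for a complete family of places. -/
theorem finprod_norm_tame_eq_one (h : IsCompletePlaces k F O) {f g : F} (hf : f ≠ 0) (hg : g ≠ 0) :
    ∏ᶠ p, Algebra.norm k (tame (O p) f g) = 1 := by
  let v (p : P) : Fˣ →* Multiplicative ℤ :=
    .mk' (fun f ↦ .ofAdd (ordv (O p) (f : F))) fun f g ↦ by
      rw [Units.val_mul, ordv_mul _ f.ne_zero g.ne_zero, ofAdd_add]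
  have := symbol_eq_one (v := v) (φ := prodNormTame h)
    (fun f g hfg ↦ prodNormTame_of_disjoint h hfg) (fun f ↦ finite_ordv_ne_zero h f.ne_zero)
    (exists_ordv_eq h.eq_of_subset) (prodNormTame_mul_swap h)
    (fun f g hfg ↦ finprod_eq_one_of_forall_eq_one fun p ↦ Units.ext (by
      rw [coe_normTame, tame_eq_one_of_add_eq_one f.ne_zero g.ne_zero hfg, map_one,
        Units.val_one]))
    (fun p f g hfg hp ↦ ordv_eq_of_add_eq_one f.ne_zero hfg hp)
    (fun p f g hfg hp ↦ ordv_eq_zero_of_add_eq_one f.ne_zero hfg hp)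
    (Units.mk0 f hf) (Units.mk0 g hg)
  rw [← Units.val_mk0 hf, ← Units.val_mk0 hg, ← coe_prodNormTame h, this, Units.val_one]

end NormTame

/-! ### Closed points of a regular curve and their local rings -/

section RegularCurve

open IsLocalRing

variable {X : Scheme.{u}} [IsRegularConnectedCurve X]

theorem coheight_le_one (x : X) : Order.coheight x ≤ 1 := by
  have := ringKrullDim_stalk_le X x
  rw [ringKrullDim_stalk_eq_coheight] at this
  exact_mod_cast this

/-- A proper specialization `y` of `x` would lie below the chain formed by `x` and the generic
point, and so have coheight at least two. -/
theorem isClosed_singleton_of_ne_genericPoint {x : X} (hx : x ≠ genericPoint X) :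
    IsClosed {x} := by
  rw [← closure_subset_iff_isClosed]
  intro y hy
  by_contra hne
  have hyx : x ⤳ y := specializes_iff_mem_closure.mpr hy
  have h1 : y < x := lt_of_le_not_ge (Scheme.le_iff_specializes.mpr hyx)
    fun h ↦ hne ((Scheme.le_iff_specializes.mp h).antisymm hyx).eq
  have h2 : x < genericPoint X := lt_of_le_not_ge
    (Scheme.le_iff_specializes.mpr (genericPoint_specializes x))
    fun h ↦ hx ((Scheme.le_iff_specializes.mp h).antisymm (genericPoint_specializes x)).eq
  have h3 := (add_le_add_left (Order.coheight_add_one_le h2) 1).trans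
    ((Order.coheight_add_one_le h1).trans (coheight_le_one y))
  have h4 : (1 + 1 : ℕ∞) ≤ 1 := (add_le_add_left le_add_self 1).trans h3
  exact absurd h4 (by decide)

/-- A closed generic point would be the only point, and the dimension would be zero. -/
theorem genericPoint_notMem_closedPoints : genericPoint X ∉ closedPoints X := by
  intro h
  have hsub : Subsingleton X := ⟨fun x y ↦ by
    have key (z : X) : z = genericPoint X := by
      have := (genericPoint_specializes z).mem_closure
      rwa [IsClosed.closure_eq h] at this
    rw [key x, key y]⟩
  have h1 := IsRegularConnectedCurve.dim_eq_one (X := X)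
  rw [topologicalKrullDim, Order.krullDim_eq_of_orderIso (irreducibleSetEquivPoints (α := X)),
    Order.krullDim_eq_zero] at h1
  norm_num at h1

theorem coheight_eq_one {p : X} (hp : p ∈ closedPoints X) : Order.coheight p = 1 := by
  refine le_antisymm (coheight_le_one p) (Order.one_le_iff_pos.mpr (pos_iff_ne_zero.mpr fun h ↦ ?_))
  rw [Order.coheight_eq_zero] at h
  have h' := h (Scheme.le_iff_specializes.mpr (genericPoint_specializes p))
  have := ((genericPoint_specializes p).antisymm (Scheme.le_iff_specializes.mp h')).eq
  exact genericPoint_notMem_closedPoints (this ▸ hp)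

/-- By regularity the cotangent space has the dimension of the ring, at most one. -/
theorem isPrincipalIdealRing_stalk (x : X) : IsPrincipalIdealRing (X.presheaf.stalk x) := by
  have := IsRegularConnectedCurve.regular x
  refine ((tfae_of_isNoetherianRing_of_isLocalRing_of_isDomain
    (X.presheaf.stalk x)).out 5 0).mp ?_
  have h := (IsRegularLocalRing.iff_finrank_cotangentSpace _).mp this
  have h' := ringKrullDim_stalk_le X x
  rw [← h] at h'
  exact_mod_cast h'

theorem isDiscreteValuationRing_stalk {p : X} (hp : p ∈ closedPoints X) :
    IsDiscreteValuationRing (X.presheaf.stalk p) := by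
  have := isPrincipalIdealRing_stalk p
  refine { not_a_field' := fun h ↦ ?_ }
  have h1 := ringKrullDim_eq_zero_of_isField (isField_iff_maximalIdeal_eq.mpr h)
  rw [ringKrullDim_stalk_eq_coheight, coheight_eq_one hp] at h1
  norm_num at h1

instance (p : closedPoints X) : IsDiscreteValuationRing (X.presheaf.stalk p.1) :=
  isDiscreteValuationRing_stalk p.2

theorem ord_eq_ordv (f : X.functionField) (p : closedPoints X) :
    Scheme.ord f p.1 = ordv (X.presheaf.stalk p.1) f :=
  Scheme.ord_eq_ordHom_of_coheight_eq_one (coheight_eq_one p.2) f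

theorem tameFunction_eq_tameFn (f g : X.functionField) (p : closedPoints X) :
    tameFunction f g p.1 = tameFn (X.presheaf.stalk p.1) f g := by
  rw [tameFunction, ord_eq_ordv, ord_eq_ordv, tameFn]

theorem tameSymbol_eq_tame (f g : X.functionField) (p : closedPoints X) :
    tameSymbol f g p.1 = tame (X.presheaf.stalk p.1) f g := by
  rw [tameSymbol, tameFunction_eq_tameFn]
  rfl

end RegularCurve

/-! ### Scalars from the base field, and separatedness -/

section Scalars

variable {k : Type u} [Field k] {X : Scheme.{u}} (s : X ⟶ Spec (.of k))

/-- The structure of a `k`-algebra on the coordinate ring of an affine scheme over `X`. -/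
noncomputable def scalars {R : CommRingCat.{u}} (i : Spec R ⟶ X) : k →+* R :=
  (Spec.preimage (i ≫ s)).hom

theorem scalars_map_comp {R S : CommRingCat.{u}} (φ : R ⟶ S) (i : Spec R ⟶ X) :
    scalars s (Spec.map φ ≫ i) = φ.hom.comp (scalars s i) := by
  have : Spec.preimage ((Spec.map φ ≫ i) ≫ s) = Spec.preimage (i ≫ s) ≫ φ :=
    Spec.map_injective (by simp)
  rw [scalars, this]
  rfl

theorem specMap_ofHom_scalars {R : CommRingCat.{u}} (i : Spec R ⟶ X) :
    Spec.map (CommRingCat.ofHom (scalars s i)) = i ≫ s :=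
  Spec.map_preimage _

theorem toResidueField_eq (p : X) :
    toResidueField s p = (X.residue p).hom.comp (scalars s (X.fromSpecStalk p)) :=
  scalars_map_comp s (X.residue p) (X.fromSpecStalk p)

/-- The inclusion of a closed point is a closed immersion, so Spec k(p) is locally of finite type
over the field `k`, hence finite. -/
theorem toResidueField_finite [LocallyOfFiniteType s] {p : X} (hp : p ∈ closedPoints X) :
    (toResidueField s p).Finite := by
  have := isClosed_singleton_iff_isClosedImmersion.mp hp
  have : IsFinite (X.fromSpecResidueField p ≫ s) :=
    isFinite_iff_locallyOfFiniteType_of_jacobsonSpace.mpr inferInstance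
  rwa [← Spec.map_preimage (X.fromSpecResidueField p ≫ s), IsFinite.SpecMap_iff] at this

variable [IsIntegral X]

theorem specMap_algebraMap_stalk (p : X) :
    Spec.map (CommRingCat.ofHom (algebraMap (X.presheaf.stalk p) X.functionField)) ≫
      X.fromSpecStalk p = X.fromSpecStalk (genericPoint X) :=
  Scheme.SpecMap_stalkSpecializes_fromSpecStalk (genericPoint_specializes p)

theorem algebraMap_scalars_stalk (p : X) (c : k) :
    algebraMap (X.presheaf.stalk p) X.functionField (scalars s (X.fromSpecStalk p) c) =
      scalars s (X.fromSpecStalk (genericPoint X)) c := by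
  rw [← specMap_algebraMap_stalk p, scalars_map_comp]
  rfl

/-- An inclusion of the local ring of `p` in that of `q` gives a second morphism from the spectrum
of the latter to `X`. By separatedness it is the canonical one, so `q` specializes to `p`, and `q`
is closed. -/
theorem eq_of_range_algebraMap_subset [IsSeparated s] {p q : X} (hq : q ∈ closedPoints X)
    [ValuationRing (X.presheaf.stalk q)]
    (h : Set.range (algebraMap (X.presheaf.stalk p) X.functionField) ⊆
      Set.range (algebraMap (X.presheaf.stalk q) X.functionField)) : p = q := by
  have hinj := IsFractionRing.injective (X.presheaf.stalk q) X.functionField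
  choose φ hφ using fun a : X.presheaf.stalk p ↦ h ⟨a, rfl⟩
  let φ' : X.presheaf.stalk p →+* X.presheaf.stalk q :=
    { toFun := φ
      map_one' := hinj (by simp [hφ])
      map_mul' := fun a b ↦ hinj (by simp [hφ])
      map_zero' := hinj (by simp [hφ])
      map_add' := fun a b ↦ hinj (by simp [hφ]) }
  have hcomp : CommRingCat.ofHom φ' ≫
      CommRingCat.ofHom (algebraMap (X.presheaf.stalk q) X.functionField) =
      CommRingCat.ofHom (algebraMap (X.presheaf.stalk p) X.functionField) := by
    ext a
    exact hφ a
  let S : ValuativeCommSq s :=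
    { R := X.presheaf.stalk q
      commRing := inferInstance
      domain := inferInstance
      K := X.functionField
      i₁ := X.fromSpecStalk (genericPoint X)
      i₂ := X.fromSpecStalk q ≫ s
      commSq := ⟨by
        rw [← specMap_algebraMap_stalk q, Category.assoc]⟩ }
  let l₁ : S.commSq.LiftStruct := ⟨X.fromSpecStalk q, specMap_algebraMap_stalk q, rfl⟩
  let l₂ : S.commSq.LiftStruct := ⟨Spec.map (CommRingCat.ofHom φ') ≫ X.fromSpecStalk p, by
      change Spec.map (CommRingCat.ofHom (algebraMap (X.presheaf.stalk q) X.functionField)) ≫ _ = _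
      rw [← Category.assoc, ← Spec.map_comp, hcomp]
      exact specMap_algebraMap_stalk p, by
      change _ = X.fromSpecStalk q ≫ s
      rw [← specMap_ofHom_scalars, ← specMap_ofHom_scalars, scalars_map_comp]
      congr 2
      ext c
      apply hinj
      rw [algebraMap_scalars_stalk, ← algebraMap_scalars_stalk s p]
      exact hφ _⟩
  have := IsSeparated.valuativeCriterion s S
  have hl : X.fromSpecStalk q = Spec.map (CommRingCat.ofHom φ') ≫ X.fromSpecStalk p :=
    congr_arg CommSq.LiftStruct.l (Subsingleton.elim l₁ l₂)
  have hmem : q ∈ Set.range (X.fromSpecStalk p) := by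
    rw [← X.fromSpecStalk_closedPoint (x := q), hl]
    exact ⟨_, rfl⟩
  rw [X.range_fromSpecStalk] at hmem
  have := (show q ⤳ p from hmem).mem_closure
  rw [IsClosed.closure_eq hq] at this
  exact this

end Scalars

/-! ### Closed points as the complete family of places -/

section Places

open IsLocalRing

variable {k : Type u} [Field k] {X : Scheme.{u}} (s : X ⟶ Spec (.of k))

theorem algebraMap_stalk_genericPoint_surjective [IsIntegral X] {x : X} (hx : x = genericPoint X) :
    Function.Surjective (algebraMap (X.presheaf.stalk x) X.functionField) := by
  subst hx
  intro y
  refine ⟨y, ?_⟩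
  change (X.presheaf.stalkSpecializes _).hom y = y
  rw [X.presheaf.stalkSpecializes_refl]
  rfl

/-- The valuation rings of the function field dominate local rings. -/
theorem exists_stalk_dominated [IsIntegral X] [UniversallyClosed s]
    (V : ValuationSubring X.functionField)
    (hV : ∀ c : k, scalars s (X.fromSpecStalk (genericPoint X)) c ∈ V) :
    ∃ (x : X) (φ : X.presheaf.stalk x →+* V), IsLocalHom φ ∧
      ∀ a, (φ a : X.functionField) = algebraMap (X.presheaf.stalk x) X.functionField a := by
  let ψ : k →+* V := (scalars s (X.fromSpecStalk (genericPoint X))).codRestrict V.toSubring hV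
  let S : ValuativeCommSq s :=
    { R := V
      K := X.functionField
      i₁ := X.fromSpecStalk (genericPoint X)
      i₂ := Spec.map (CommRingCat.ofHom ψ)
      commSq := ⟨by
        rw [← specMap_ofHom_scalars, ← Spec.map_comp]
        rfl⟩ }
  have hex : ValuativeCriterion.Existence s :=
    (UniversallyClosed.eq_valuativeCriterion ▸ ‹UniversallyClosed s› :
      (ValuativeCriterion.Existence ⊓ @QuasiCompact) s).1
  obtain ⟨l, hl₁, -⟩ := (hex S).exists_lift
  let l' : Spec (.of V) ⟶ X := l
  refine ⟨l' (closedPoint V), (Scheme.stalkClosedPointTo l').hom, inferInstance, fun a ↦ ?_⟩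
  -- The two ring maps from the stalk to `F` are compared through the morphisms Spec F → X they
  -- induce; the spectrum of a stalk maps monomorphically to `X`.
  have hl : Spec.map (Scheme.stalkClosedPointTo l' ≫
      CommRingCat.ofHom (algebraMap V X.functionField)) ≫ X.fromSpecStalk _ =
      Spec.map (CommRingCat.ofHom (algebraMap (X.presheaf.stalk (l' (closedPoint V)))
        X.functionField)) ≫ X.fromSpecStalk _ := by
    rw [specMap_algebraMap_stalk, Spec.map_comp, Category.assoc,
      Scheme.Spec_stalkClosedPointTo_fromSpecStalk]
    exact hl₁
  rw [cancel_mono] at hl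
  exact congr($(Spec.map_injective hl).hom a)

/-- `V` dominates the local ring of some point, which is not generic because `V ≠ ⊤`. That local
ring is a discrete valuation ring, and valuation rings are maximal for domination. -/
theorem exists_mem_iff_of_valuationSubring [IsRegularConnectedCurve X] [UniversallyClosed s]
    (V : ValuationSubring X.functionField)
    (hV : ∀ c : k, scalars s (X.fromSpecStalk (genericPoint X)) c ∈ V) (hne : V ≠ ⊤) :
    ∃ p : closedPoints X, ∀ y, y ∈ V ↔
      ∃ a : X.presheaf.stalk p.1, algebraMap (X.presheaf.stalk p.1) X.functionField a = y := by
  obtain ⟨x, φ, hφ, hφa⟩ := exists_stalk_dominated s V hV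
  have hx : x ≠ genericPoint X := by
    refine fun hx ↦ hne (eq_top_iff.mpr fun y _ ↦ ?_)
    obtain ⟨a, rfl⟩ := algebraMap_stalk_genericPoint_surjective hx y
    rw [← hφa]
    exact (φ a).2
  refine ⟨⟨x, isClosed_singleton_of_ne_genericPoint hx⟩, fun y ↦ ⟨fun hy ↦ ?_, ?_⟩⟩
  · have := isDiscreteValuationRing_stalk (isClosed_singleton_of_ne_genericPoint hx)
    rcases ValuationRing.isInteger_or_isInteger (X.presheaf.stalk x) y with h | ⟨a, ha⟩
    · exact h
    · by_cases hy0 : y = 0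
      · exact ⟨0, by rw [map_zero, hy0]⟩
      have hu : IsUnit (φ a) := by
        refine .of_mul_eq_one ⟨y, hy⟩ (Subtype.ext ?_)
        change (φ a : X.functionField) * y = 1
        rw [hφa, ha, inv_mul_cancel₀ hy0]
      obtain ⟨b, hb⟩ := (hφ.map_nonunit a hu).exists_right_inv
      refine ⟨b, ?_⟩
      have := congr_arg (algebraMap (X.presheaf.stalk x) X.functionField) hb
      rw [map_mul, map_one, ha] at this
      exact (eq_of_inv_mul_eq_one this).symm
  · rintro ⟨a, rfl⟩
    rw [← hφa]
    exact (φ a).2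

/-- The localizations at maximal ideals are stalks, which are principal ideal domains. -/
theorem isIntegrallyClosed_of_isAffineOpen [IsRegularConnectedCurve X] {U : X.Opens}
    (hU : IsAffineOpen U) [Nonempty U] : IsIntegrallyClosed Γ(X, U) := by
  refine .of_localization_maximal fun P _ _ ↦ ?_
  let y : PrimeSpectrum Γ(X, U) := ⟨P, inferInstance⟩
  have hy : hU.fromSpec y ∈ U := by
    have : hU.fromSpec y ∈ Set.range hU.fromSpec := ⟨y, rfl⟩
    rwa [hU.range_fromSpec] at this
  let := TopCat.Presheaf.algebra_section_stalk X.presheaf ⟨hU.fromSpec y, hy⟩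
  have : IsLocalization.AtPrime (X.presheaf.stalk (hU.fromSpec y)) P := hU.isLocalization_stalk' y hy
  have := isPrincipalIdealRing_stalk (hU.fromSpec y)
  have : IsIntegrallyClosed (X.presheaf.stalk (hU.fromSpec y)) := inferInstance
  exact .of_equiv (IsLocalization.algEquiv P.primeCompl (X.presheaf.stalk (hU.fromSpec y))
    (Localization.AtPrime P)).toRingEquiv

theorem exists_isAffineOpen_germ_eq {p : X} (t : X.presheaf.stalk p) :
    ∃ (U : X.Opens) (_ : IsAffineOpen U) (hp : p ∈ U) (a : Γ(X, U)), X.presheaf.germ U p hp a = t := by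
  obtain ⟨U, hU, g, hg⟩ := X.presheaf.exists_germ_eq t
  obtain ⟨_, ⟨A, hA, rfl⟩, hpA, hAU⟩ :=
    X.isBasis_affineOpens.exists_subset_of_mem_open hU U.isOpen
  exact ⟨A, hA, hpA, X.presheaf.map (homOfLE hAU).op g,
    (X.presheaf.germ_res_apply (homOfLE hAU) p hpA g).trans hg⟩

/-- `S` is the coordinate ring of an affine neighbourhood of `p` on which `t` is defined. -/
theorem exists_subalgebra_of_stalk [IsRegularConnectedCurve X] [LocallyOfFiniteType s]
    [Algebra k X.functionField]
    (hk : ∀ c, algebraMap k X.functionField c = scalars s (X.fromSpecStalk (genericPoint X)) c)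
    {p : X} (t : X.presheaf.stalk p) :
    ∃ S : Subalgebra k X.functionField, S.FG ∧
      algebraMap (X.presheaf.stalk p) X.functionField t ∈ S ∧
      (∀ x ∈ S, ∃ a, algebraMap (X.presheaf.stalk p) X.functionField a = x) ∧
      ∀ x : X.functionField, IsIntegral S x → x ∈ S := by
  obtain ⟨U, hU, hp, a, rfl⟩ := exists_isAffineOpen_germ_eq t
  have : Nonempty U := ⟨⟨p, hp⟩⟩
  have hη : genericPoint X ∈ U :=
    ((genericPoint_spec X).mem_open_set_iff U.isOpen).mpr (by simpa using this)
  have hft : (scalars s hU.fromSpec).FiniteType := by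
    have : LocallyOfFiniteType (Spec.map (CommRingCat.ofHom (scalars s hU.fromSpec))) := by
      rw [specMap_ofHom_scalars]
      infer_instance
    exact (HasRingHomProperty.Spec_iff (P := @LocallyOfFiniteType)).mp this
  let := (scalars s hU.fromSpec).toAlgebra
  let ψ : Γ(X, U) →ₐ[k] X.functionField :=
    { toRingHom := algebraMap Γ(X, U) X.functionField
      commutes' := fun c ↦ by
        rw [hk, ← hU.fromSpecStalk_eq_fromSpecStalk hη, IsAffineOpen.fromSpecStalk,
          scalars_map_comp]
        rfl }
  have hψ (b : Γ(X, U)) : ψ b =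
      algebraMap (X.presheaf.stalk p) X.functionField (X.presheaf.germ U p hp b) :=
    (Scheme.algebraMap_germ_eq_germToFunctionField X hp b).symm
  refine ⟨ψ.range, ?_, ⟨a, hψ a⟩, ?_, fun x hx ↦ ?_⟩
  · rw [← Algebra.map_top]
    exact Subalgebra.FG.map ψ hft.out
  · rintro _ ⟨b, rfl⟩
    exact ⟨_, (hψ b).symm⟩
  · have := isIntegrallyClosed_of_isAffineOpen hU
    have := functionField_isFractionRing_of_isAffineOpen X U hU
    have hx' : IsIntegral Γ(X, U) x := by
      let := ψ.rangeRestrict.toRingHom.toAlgebra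
      have : IsScalarTower Γ(X, U) ψ.range X.functionField := .of_algebraMap_eq fun _ ↦ rfl
      have := Algebra.isIntegral_of_surjective (R := Γ(X, U)) (B := ψ.range)
        ψ.rangeRestrict_surjective
      exact isIntegral_trans x hx
    obtain ⟨b, hb⟩ := IsIntegrallyClosed.isIntegral_iff.mp hx'
    exact ⟨b, hb⟩

theorem algebraMap_residueField_eq {p : X} [Algebra k (X.presheaf.stalk p)]
    (hk : ∀ c, algebraMap k (X.presheaf.stalk p) c = scalars s (X.fromSpecStalk p) c) :
    algebraMap k (ResidueField (X.presheaf.stalk p)) = toResidueField s p := by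
  rw [toResidueField_eq]
  ext c
  exact congr_arg (residue (X.presheaf.stalk p)) (hk c)

/-- The `k`-algebra structure from Spec k(p) → Spec k agrees with the one induced from the stalk. -/
theorem residueNorm_eq_norm {p : X} [Algebra k (X.presheaf.stalk p)]
    (hk : ∀ c, algebraMap k (X.presheaf.stalk p) c = scalars s (X.fromSpecStalk p) c) :
    residueNorm s p = (Algebra.norm k : ResidueField (X.presheaf.stalk p) →* k) := by
  have : (toResidueField s p).toAlgebra =
      (inferInstance : Algebra k (ResidueField (X.presheaf.stalk p))) :=
    Algebra.algebra_ext _ _ fun c ↦ congr($(algebraMap_residueField_eq s hk) c).symm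
  change @Algebra.norm k (X.residueField p) _ _ (toResidueField s p).toAlgebra = _
  rw [this]
  rfl

/-- The closed points of a proper regular curve are all places of its function field. -/
theorem isCompletePlaces_closedPoints [IsRegularConnectedCurve X] [IsProper s]
    [Algebra k X.functionField]
    (hk : ∀ c, algebraMap k X.functionField c = scalars s (X.fromSpecStalk (genericPoint X)) c)
    [∀ p : closedPoints X, Algebra k (X.presheaf.stalk p.1)]
    (hkp : ∀ (p : closedPoints X) c,
      algebraMap k (X.presheaf.stalk p.1) c = scalars s (X.fromSpecStalk p.1) c) :
    IsCompletePlaces k X.functionField fun p : closedPoints X ↦ X.presheaf.stalk p.1 where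
  finite_residueField p := by
    rw [← RingHom.finite_algebraMap, algebraMap_residueField_eq s (hkp p)]
    exact toResidueField_finite s p.2
  eq_of_subset p q h := Subtype.ext (eq_of_range_algebraMap_subset s q.2 h)
  exists_eq V hV hne := exists_mem_iff_of_valuationSubring s V (fun c ↦ hk c ▸ hV c) hne
  exists_subalgebra p t := exists_subalgebra_of_stalk s hk t

end Places

end WeilReciprocity

/-! ### Weil reciprocity on the curve -/

open WeilReciprocity in
theorem mainTheorem3 {k : Type u} [Field k] (X : Scheme.{u}) [IsRegularConnectedCurve X]
    (s : X ⟶ Spec (.of k)) [IsProper s]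
    (f g : X.functionField) (hf : f ≠ 0) (hg : g ≠ 0) :
    (∀ p ∈ closedPoints X, (toResidueField s p).Finite ∧
      ∃ a : (X.presheaf.stalk p)ˣ,
        algebraMap (X.presheaf.stalk p) X.functionField a = tameFunction f g p) ∧
    {p ∈ closedPoints X | tameSymbol f g p ≠ 1}.Finite ∧
    (∏ᶠ p ∈ closedPoints X, residueNorm s p (tameSymbol f g p)) = 1 := by
  -- The function field and the stalks get their `k`-algebra structures from `s`, which makes them
  -- compatible.
  let : Algebra k X.functionField := (scalars s (X.fromSpecStalk (genericPoint X))).toAlgebra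
  let (p : closedPoints X) : Algebra k (X.presheaf.stalk p.1) :=
    (scalars s (X.fromSpecStalk p.1)).toAlgebra
  have (p : closedPoints X) : IsScalarTower k (X.presheaf.stalk p.1) X.functionField :=
    .of_algebraMap_eq fun c ↦ (algebraMap_scalars_stalk s p.1 c).symm
  have h := isCompletePlaces_closedPoints s (fun _ ↦ rfl) fun _ _ ↦ rfl
  refine ⟨fun p hp ↦ ⟨toResidueField_finite s hp, ?_⟩, ?_, ?_⟩
  · have := isDiscreteValuationRing_stalk hp
    rw [tameFunction_eq_tameFn f g ⟨p, hp⟩]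
    exact exists_unit_of_ordv_eq_zero _ (tameFn_ne_zero hf hg) (ordv_tameFn hf hg)
  · refine ((finite_tame_ne_one h hf hg).image Subtype.val).subset fun p hp ↦ ?_
    refine ⟨⟨p, hp.1⟩, fun hcon ↦ hp.2 ?_, rfl⟩
    rw [tameSymbol_eq_tame f g ⟨p, hp.1⟩, hcon]
    rfl
  · rw [← finprod_set_coe_eq_finprod_mem (s := closedPoints X)
      (f := fun p ↦ residueNorm s p (tameSymbol f g p)), ← finprod_norm_tame_eq_one h hf hg]
    refine finprod_congr fun p ↦ ?_
    rw [tameSymbol_eq_tame, residueNorm_eq_norm s (p := p.1) fun _ ↦ rfl]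
    rfl
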